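/- Work in the random oracle model. Public parameters are the key length $\kappa\ge 1$, the number of states $|Q|\ge 1$, the alphabet $\Sigma$, and the input length $n\ge 1$. The server holds a finite-state machine $\mathcal M=(Q,q_0,\Sigma,\delta,Q_{\mathsf{accept}})$, the client a string $x=x_1\ldots x_n\in\Sigma^n$, and the helper has no input. Write $\mathcal M(x)\in\{0,1\}$ for the acceptance bit. The hash functions $H:\{0,1\}^{\kappa+\lceil\log|\Sigma|\rceil}\to\{0,1\}^{\lceil\log|Q|\rceil+\kappa}$ and $H':\{0,1\}^{\kappa+\lceil\log n\rceil}\to(\{0,1\}^{\lceil\log|Q|\rceil+\kappa})^{|Q|}$ are independent random oracles. The protocol $\pi_{\mathsf{Helper}}$ is the following. \begin{enumerate} \item The server picks independent uniform keys $k^i_q\in\{0,1\}^\kappa$, rotations $r_i\in\mathbb Z_{|Q|}$ ($1\le i\le n$, $q\in\mathbb{Z}_{|Q|}\cong Q$), a bit $r$ (its output share), and a key $k_{SH}\in\{0,1\}^\kappa$. With $q'=\delta(q-r_i,\sigma)$ it sets $G(q,\sigma,i)=H(k^i_q\|\sigma)\oplus\big(q'+r_{i+1}\,\|\,k^{i+1}_{q'+r_{i+1}}\big)$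 for $i<n$, and $G(q,\sigma,n)=H(k^n_q\|\sigma)\oplus (r\oplus[q'\in Q_{\mathsf{accept}}])$ (the bit being padded with zeros). It sends all $G(q,\sigma,i)$ and $k_{SH}$ to the helper. \item The client picks uniform bits $x^S_{i,j}$ and puts $x^H_{i,j}=x^S_{i,j}\oplus x_{i,j}$, where $x_{i,j}=1$ if $x_i=j$ and $x_{i,j}=0$ otherwise. It sends $(x^S_{i,j})$ to the server and $(x^H_{i,j})$ to the helper. \item For each $i$, the server sends to the client $\bigoplus_{j:x^S_{i,j}=1}G(\cdot,j,i)\oplus H'(k_{SH}\|i)$, and the helper sends $\bigoplus_{j:x^H_{i,j}=1}G(\cdot,j,i)\oplus H'(k_{SH}\|i)$. The server also sends the rotated initial state $q_1=q_0+r_1$ and its key $k^1_{q_1}$. \item The client XORs the two answers for each $i$, and then, starting from $(q_1,k^1_{q_1})$, decrypts one entry of each resulting column in turn; the last one gives its output share. The output of the server is $r$. \end{enumerate} The following hold. \begin{enumerate} \item[(a)] (Correctness) For all inputs, oracles and coins, the XOR of the two answers for position $i$ is the column $G(\cdot,x_i,i)$, and the client's output is $r\oplus\mathcal M(x)$. \item[(b)]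 (Simulation security against a semi-honest client) There is a probabilistic simulator with oracle access to $H,H'$ (a straight-line program that may also sample uniformly from $\{0,\ldots,m\}$), whose cost is polynomial in $\kappa+|Q|+|\Sigma|+n$, such that the following holds. Let $\kappa\ge\lambda$, $|Q|$, $|\Sigma|$, $n$ be polynomially bounded functions of the security parameter $\lambda$, and let $(\mathcal M_\lambda)$, $(x_\lambda)$ be families of inputs. Then no family of distinguishers that make polynomially many queries to $H,H'$ (and are otherwise computationally unbounded and probabilistic) tells apart, with more than negligible advantage, the pair consisting of the client's view in $\pi_{\mathsf{Helper}}$ (its input, its coins, the messages it receives) and the server's output $r$, and the pair consisting of the output of the simulator on $(x,z)$ and $r$, where $r$ is a uniform bit and $z=r\oplus\mathcal M(x)$. \item[(c)] (Privacy against a malicious server) For parameters as in (b), let a malicious server, probabilistic and with polynomially many oracle queries, choose $x^{(0)},x^{(1)}\in\Sigma^n$; for a uniform bit $b$, the honest client and the honest helper run $\pi_{\mathsf{Helper}}$ with it, the client on input $x^{(b)}$; the server sends arbitrary messages and finally outputs $b'$. Then $|\Pr[b'=b]-\tfrac12|$ is negligible. \item[(d)] (Privacy against a malicious helper) For parameters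 as in (b), let a malicious helper, probabilistic and with polynomially many oracle queries, choose two pairs $(\mathcal M^{(0)},x^{(0)})$, $(\mathcal M^{(1)},x^{(1)})$ of inputs with the given public parameters; for a uniform bit $b$, the honest server and the honest client run $\pi_{\mathsf{Helper}}$ with it on inputs $\mathcal M^{(b)}$ and $x^{(b)}$; the helper sends arbitrary messages and finally outputs $b'$. Then $|\Pr[b'=b]-\tfrac12|$ is negligible. \end{enumerate} In each of (b), (c), (d) exactly one party is corrupted (no collusion). -/

import Mathlib

open Filter

namespace HelperProtocol

/-! ### Public parameters, bit strings, random oracles -/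

/-- Public parameters of one protocol instance: key length `κ`, number of states `nQ`,
size `nS` of the alphabet, and length `n` of the client's input. -/
structure Params where
  κ : ℕ
  nQ : ℕ
  nS : ℕ
  n : ℕ
  pos_κ : NeZero κ
  pos_nQ : NeZero nQ
  pos_n : NeZero n

attribute [instance] Params.pos_κ Params.pos_nQ Params.pos_n

/-- Bit strings of length `w`; XOR is the addition `+`. -/
abbrev Bits (w : ℕ) : Type := Fin w → ZMod 2

/-- Binary representation of `v` on `w` bits (least significant bit first). -/
def toBits (w v : ℕ) : Bits w := fun j => if v.testBit j then 1 else 0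

/-- The number with a given binary representation. -/
def ofBits {w : ℕ} (b : Bits w) : ℕ := ∑ j : Fin w, (b j).val * 2 ^ (j : ℕ)

namespace Params

variable (P : Params)

/-- Bit length of a state. -/
def lQ : ℕ := Nat.clog 2 P.nQ

/-- Bit length of a symbol. -/
def lS : ℕ := Nat.clog 2 P.nS

/-- Bit length of a position of the input. -/
def ln : ℕ := Nat.clog 2 P.n

/-- Overall size of the parameters. -/
def size : ℕ := P.κ + P.nQ + P.nS + P.n

end Params

/-- Keys: bit strings of length `κ`. -/
abbrev Key (P : Params) : Type := Bits P.κ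

/-- Entries of the garbled matrices: bit strings of length `⌈log nQ⌉ + κ`, written as the
concatenation (pair) of a state field and a key field. -/
abbrev Entry (P : Params) : Type := Bits P.lQ × Bits P.κ

/-- Columns of the garbled matrices, indexed by the (rotated) states. -/
abbrev Column (P : Params) : Type := Fin P.nQ → Entry P

/-- The two hash functions, modelled as random oracles: `H`, taking `k ‖ σ` to an entry,
and `mask` (written `H'` in the literature), taking `k ‖ i` to a column. -/
abbrev Oracles (P : Params) : Type :=
  (Key P × Bits P.lS → Entry P) × (Key P × Bits P.ln → Column P)

def Oracles.H {P : Params} (O : Oracles P) (k : Key P) (s : Bits P.lS) : Entry P := O.1 (k, s)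

def Oracles.mask {P : Params} (O : Oracles P) (k : Key P) (i : Bits P.ln) : Column P := O.2 (k, i)

/-! ### Finite-state machines -/

/-- The server's input: a finite-state machine with `nQ` states over `nS` symbols. -/
abbrev FSM (P : Params) : Type := DFA (Fin P.nS) (Fin P.nQ)

/-- The client's input: a string of length `n`. -/
abbrev Input (P : Params) : Type := Fin P.n → Fin P.nS

open Classical in
/-- The acceptance bit of a state. -/
noncomputable def acceptBit {P : Params} (M : FSM P) (q : Fin P.nQ) : ZMod 2 :=
  if q ∈ M.accept then 1 else 0

/-- Output bit of the machine `M` on the string `x`. -/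
noncomputable def result {P : Params} (M : FSM P) (x : Input P) : ZMod 2 :=
  acceptBit M (M.eval (List.ofFn x))

/-! ### The protocol -/

/-- The server's randomness: state keys `k i q`, rotations `rot i`, output mask `r`
(the server's share of the output), and the key `kSH` shared with the helper. -/
structure ServerCoins (P : Params) where
  k : Fin P.n → Fin P.nQ → Key P
  rot : Fin P.n → Fin P.nQ
  r : ZMod 2
  kSH : Key P

/-- All the server's random values are independent and uniform. -/
noncomputable def sampleServerCoins (P : Params) : PMF (ServerCoins P) := do
  let k ← PMF.uniformOfFintype (Fin P.n → Fin P.nQ → Key P)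
  let rot ← PMF.uniformOfFintype (Fin P.n → Fin P.nQ)
  let r ← PMF.uniformOfFintype (ZMod 2)
  let kSH ← PMF.uniformOfFintype (Key P)
  pure ⟨k, rot, r, kSH⟩

/-- An output share, padded with zeros to the length of an entry. -/
def padShare {P : Params} (z : ZMod 2) : Entry P := (0, fun j => if j = 0 then z else 0)

/-- The plaintext of row `q` (rotated state), column `s` in the `i`-th matrix: the rotated next
state with its key, and in the last matrix the masked acceptance bit of the next state. -/
noncomputable def payload {P : Params} (M : FSM P) (c : ServerCoins P)
    (i : Fin P.n) (s : Fin P.nS) (q : Fin P.nQ) : Entry P :=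
  let q' := M.step (q - c.rot i) s
  if h : (i : ℕ) + 1 < P.n then
    (toBits P.lQ (q' + c.rot ⟨i + 1, h⟩ : Fin P.nQ), c.k ⟨i + 1, h⟩ (q' + c.rot ⟨i + 1, h⟩))
  else padShare (c.r + acceptBit M q')

/-- The garbled matrices; `G i s` is the column of the symbol `s` in the `i`-th matrix. -/
abbrev Garbled (P : Params) : Type := Fin P.n → Fin P.nS → Column P

noncomputable def garble {P : Params} (O : Oracles P) (M : FSM P) (c : ServerCoins P) :
    Garbled P :=
  fun i s q => O.H (c.k i q) (toBits P.lS s) + payload M c i s q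

/-- One share of the one-hot encoded input. -/
abbrev Shares (P : Params) : Type := Fin P.n → Fin P.nS → ZMod 2

/-- One-hot encoding of the input. -/
def oneHot {P : Params} (x : Input P) : Shares P := fun i j => if x i = j then 1 else 0

/-- The share for the helper, when the (uniformly random) share for the server is `a`. -/
def helperShares {P : Params} (x : Input P) (a : Shares P) : Shares P := oneHot x + a

/-- What the server sends to the helper: the garbled matrices and the key `kSH`. -/
abbrev SetupMsg (P : Params) : Type := Garbled P × Key P

noncomputable def setupMsg {P : Params} (O : Oracles P) (M : FSM P) (c : ServerCoins P) :
    SetupMsg P := (garble O M c, c.kSH)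

/-- The masked partial answers of the server or the helper, one column for each position. -/
abbrev Answer (P : Params) : Type := Fin P.n → Column P

def partialAnswer {P : Params} (O : Oracles P) (m : SetupMsg P) (s : Shares P) : Answer P :=
  fun i => (∑ j ∈ Finset.univ.filter (fun j => s i j = 1), m.1 i j)
    + O.mask m.2 (toBits P.ln i)

/-- The (rotated) initial state, together with its key. -/
abbrev Start (P : Params) : Type := Fin P.nQ × Key P

def startMsg {P : Params} (M : FSM P) (c : ServerCoins P) : Start P :=
  (M.start + c.rot 0, c.k 0 (M.start + c.rot 0))

/-- The client's view: its input, its randomness (the shares it sent to the server), the messages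
of the server (`ansS`, `start`) and of the helper (`ansH`). -/
structure ClientView (P : Params) where
  x : Input P
  coins : Shares P
  ansS : Answer P
  start : Start P
  ansH : Answer P

/-- The client's view in an execution in which all parties follow the protocol. -/
noncomputable def clientView {P : Params} (O : Oracles P) (M : FSM P) (x : Input P)
    (c : ServerCoins P) (a : Shares P) : ClientView P where
  x := x
  coins := a
  ansS := partialAnswer O (setupMsg O M c) a
  start := startMsg M c
  ansH := partialAnswer O (setupMsg O M c) (helperShares x a)

/-- The columns that the client recovers by XORing the two partial answers. -/
def ClientView.columns {P : Params} (v : ClientView P) : Fin P.n → Column P :=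
  fun i => v.ansS i + v.ansH i

/-- One step of the client's evaluation: decrypt the row of the current state. -/
def evalStep {P : Params} (O : Oracles P) (v : ClientView P) (cur : Start P) (i : Fin P.n) :
    Start P :=
  let e := v.columns i cur.1 + O.H cur.2 (toBits P.lS (v.x i))
  (Fin.ofNat P.nQ (ofBits e.1), e.2)

/-- The client's output share: evaluate all the columns, and read the share off the entry
that was decrypted last. -/
def clientOutput {P : Params} (O : Oracles P) (v : ClientView P) : ZMod 2 :=
  ((List.finRange P.n).foldl (evalStep O v) v.start).2 0

/-! ### Adversaries -/

/-- Probabilistic computations with access to the two random oracles, and with no other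
restriction on their computing power. -/
inductive OracleComp (P : Params) (α : Type) : Type
  | done (a : α) : OracleComp P α
  | random (μ : PMF ℕ) (next : ℕ → OracleComp P α) : OracleComp P α
  | queryH (k : Key P) (s : Bits P.lS) (next : Entry P → OracleComp P α) : OracleComp P α
  | queryMask (k : Key P) (i : Bits P.ln) (next : Column P → OracleComp P α) : OracleComp P α

namespace OracleComp

variable {P : Params} {α : Type}

/-- The output distribution of a computation when the oracles are `O`. -/
noncomputable def run (O : Oracles P) : OracleComp P α → PMF α
  | done a => PMF.pure a
  | random μ next => μ.bind fun v => (next v).run O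
  | queryH k s next => (next (O.H k s)).run O
  | queryMask k i next => (next (O.mask k i)).run O

/-- The computation makes at most `T` oracle queries. -/
def QueryBound : OracleComp P α → ℕ → Prop
  | done _, _ => True
  | random _ next, T => ∀ v, (next v).QueryBound T
  | queryH _ _ next, T => 0 < T ∧ ∀ e, (next e).QueryBound (T - 1)
  | queryMask _ _ next, T => 0 < T ∧ ∀ e, (next e).QueryBound (T - 1)

end OracleComp

/-- A function of the security parameter that is bounded by a polynomial. -/
def PolyBounded (f : ℕ → ℕ) : Prop := ∃ c : ℕ, ∀ l, f l ≤ (l + 2) ^ c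

/-- A negligible function of the security parameter. -/
def Negligible (f : ℕ → ℝ) : Prop :=
  Asymptotics.SuperpolynomialDecay atTop (fun l : ℕ => (l : ℝ)) f

/-- Parameters as functions of the security parameter `l`: keys of length at least `l`, and all
sizes polynomial in `l`. -/
def Admissible (P : ℕ → Params) : Prop :=
  (∀ l, l ≤ (P l).κ) ∧ PolyBounded fun l => (P l).size

/-! ### Simulators: probabilistic straight-line programs with oracle gates, with their cost -/

/-- Memory of a program: one bit at each address. -/
abbrev Mem : Type := ℕ → ZMod 2

/-- Read the `w` bits from address `a` on. -/
def Mem.read (m : Mem) (a w : ℕ) : Bits w := fun j => m (a + j)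

/-- Write a string of `w` bits from address `d` on. -/
def Mem.write (m : Mem) (d : ℕ) {w : ℕ} (b : Bits w) : Mem :=
  fun a => if h : d ≤ a ∧ a - d < w then b ⟨a - d, h.2⟩ else m a

/-- Write an entry from address `d` on, the state field first. -/
def Mem.writeEntry {P : Params} (m : Mem) (d : ℕ) (e : Entry P) : Mem :=
  (m.write d e.1).write (d + P.lQ) e.2

/-- Write a column from address `d` on, row after row. -/
def Mem.writeColumn {P : Params} (m : Mem) (d : ℕ) (C : Column P) : Mem :=
  (List.finRange P.nQ).foldl (fun m' (q : Fin P.nQ) => m'.writeEntry (d + (q : ℕ) * (P.lQ + P.κ)) (C q)) m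

/-- Instructions; `d` is the address that is written, `a` and `b` are addresses that are read.
* `one`: write the bit 1.
* `xor`, `and`: write the XOR, or the AND, of two bits.
* `uniform`: write in binary a fresh uniformly random number from `{0, …, m}` (for `m + 1` that is
  no power of two, this is what rejection sampling does in expected time linear in the number
  of bits).
* `hash`: query `H` on the key at `a` and the symbol at `b`.
* `mask`: query `mask` on the key at `a` and the position at `b`. -/
inductive Instr : Type
  | one (d : ℕ)
  | xor (d a b : ℕ)
  | and (d a b : ℕ)
  | uniform (d m : ℕ)
  | hash (d a b : ℕ)
  | mask (d a b : ℕ)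

/-- The cost of an instruction: one, plus the number of bits that a sampling or an oracle
instruction reads and writes. -/
def Instr.cost (P : Params) : Instr → ℕ
  | one _ => 1
  | xor _ _ _ => 1
  | and _ _ _ => 1
  | uniform _ m => Nat.clog 2 (m + 1) + 1
  | hash _ _ _ => (P.κ + P.lS) + (P.lQ + P.κ) + 1
  | mask _ _ _ => (P.κ + P.ln) + P.nQ * (P.lQ + P.κ) + 1

noncomputable def Instr.exec {P : Params} (O : Oracles P) (m : Mem) : Instr → PMF Mem
  | one d => PMF.pure (Function.update m d 1)
  | xor d a b => PMF.pure (Function.update m d (m a + m b))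
  | and d a b => PMF.pure (Function.update m d (m a * m b))
  | uniform d u => (PMF.uniformOfFintype (Fin (u + 1))).map
      fun v => m.write d (toBits (Nat.clog 2 (u + 1)) v)
  | hash d a b => PMF.pure (m.writeEntry d (O.H (m.read a P.κ) (m.read b P.lS)))
  | mask d a b => PMF.pure (m.writeColumn d (O.mask (m.read a P.κ) (m.read b P.ln)))

noncomputable def execProg {P : Params} (O : Oracles P) : List Instr → Mem → PMF Mem
  | [], m => PMF.pure m
  | I :: prog, m => (I.exec O m).bind fun m' => execProg O prog m'

/-- The initial memory: the client's output share `z` at address `0`, and then the symbols of the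
client's input in binary, `lS` bits each. -/
def loadInput {P : Params} (x : Input P) (z : ZMod 2) : Mem
  | 0 => z
  | a + 1 => if h : a / P.lS < P.n then
      (if (x ⟨a / P.lS, h⟩ : ℕ).testBit (a % P.lS) then 1 else 0) else 0

/-- Simulator for the client: a straight-line program, and the addresses at which the bits of the
simulated view (other than the input `x`) are found when the program has ended. -/
structure Simulator (P : Params) where
  prog : List Instr
  coins : Fin P.n → Fin P.nS → ℕ
  ansS : Fin P.n → Fin P.nQ → ℕ
  startState : ℕ
  startKey : ℕ
  ansH : Fin P.n → Fin P.nQ → ℕ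

namespace Simulator

variable {P : Params}

def cost (S : Simulator P) : ℕ := (S.prog.map (Instr.cost P)).sum

def view (S : Simulator P) (x : Input P) (m : Mem) : ClientView P where
  x := x
  coins := fun i j => m (S.coins i j)
  ansS := fun i q => (m.read (S.ansS i q) P.lQ, m.read (S.ansS i q + P.lQ) P.κ)
  start := (Fin.ofNat P.nQ (ofBits (m.read S.startState P.lQ)), m.read S.startKey P.κ)
  ansH := fun i q => (m.read (S.ansH i q) P.lQ, m.read (S.ansH i q + P.lQ) P.κ)

/-- The simulated view, computed from the client's input `x` and output share `z` only. -/
noncomputable def run (O : Oracles P) (S : Simulator P) (x : Input P) (z : ZMod 2) :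
    PMF (ClientView P) :=
  (execProg O S.prog (loadInput x z)).map (S.view x)

end Simulator

/-! ### Security against a semi-honest client -/

/-- A distinguisher, given a view of the client and the output of the honest server. -/
abbrev Distinguisher (P : Params) : Type := ClientView P → ZMod 2 → OracleComp P Bool

/-- Real world: the distinguisher gets the client's view in the protocol and the server's output. -/
noncomputable def realClient {P : Params} (M : FSM P) (x : Input P) (D : Distinguisher P) :
    PMF Bool := do
  let O ← PMF.uniformOfFintype (Oracles P)
  let c ← sampleServerCoins P
  let a ← PMF.uniformOfFintype (Shares P)
  (D (clientView O M x c a) c.r).run O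

/-- Ideal world: the functionality shares the result of `M` on `x` between the server (share `r`)
and the client (share `z`), and the simulator gets `x` and `z`. -/
noncomputable def idealClient {P : Params} (S : Simulator P) (M : FSM P) (x : Input P)
    (D : Distinguisher P) : PMF Bool := do
  let O ← PMF.uniformOfFintype (Oracles P)
  let r ← PMF.uniformOfFintype (ZMod 2)
  let z := r + result M x
  let v ← S.run O x z
  (D v r).run O

/-! ### Privacy against a malicious server -/

/-- A malicious server chooses two inputs for the client; then, on receiving its shares from the
client, it sends arbitrary messages to the helper and to the client, and makes its guess. -/
structure MaliciousServer (P : Params) where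
  State : Type
  choose : OracleComp P (Input P × Input P × State)
  respond : State → Shares P → OracleComp P ((SetupMsg P × Answer P × Start P) × Bool)

def MaliciousServer.QueryBound {P : Params} (A : MaliciousServer P) (T : ℕ) : Prop :=
  A.choose.QueryBound T ∧ ∀ st a, (A.respond st a).QueryBound T

/-- The protocol with a malicious server, and an honest client and helper; the result is the
client's output together with the guess. Neither the helper nor the client sends anything to the
server after the shares. -/
noncomputable def MaliciousServer.exec {P : Params} (A : MaliciousServer P) (O : Oracles P)
    (st : A.State) (x : Input P) : PMF (ZMod 2 × Bool) := do
  let a ← PMF.uniformOfFintype (Shares P)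
  let out ← (A.respond st a).run O
  let ansH := partialAnswer O out.1.1 (helperShares x a)
  pure (clientOutput O ⟨x, a, out.1.2.1, out.1.2.2, ansH⟩, out.2)

/-- The privacy game for a malicious server; the outcome says whether it guessed right. -/
noncomputable def MaliciousServer.game {P : Params} (A : MaliciousServer P) : PMF Bool := do
  let O ← PMF.uniformOfFintype (Oracles P)
  let ch ← A.choose.run O
  let b ← PMF.uniformOfFintype Bool
  let out ← A.exec O ch.2.2 (if b then ch.2.1 else ch.1)
  pure (out.2 == b)

/-! ### Privacy against a malicious helper -/

/-- A malicious helper chooses two pairs of inputs for the server and the client; then, on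
receiving the messages of the server and the client, it sends an arbitrary message to the client,
and makes its guess. -/
structure MaliciousHelper (P : Params) where
  State : Type
  choose : OracleComp P ((FSM P × Input P) × (FSM P × Input P) × State)
  respond : State → SetupMsg P → Shares P → OracleComp P (Answer P × Bool)

def MaliciousHelper.QueryBound {P : Params} (A : MaliciousHelper P) (T : ℕ) : Prop :=
  A.choose.QueryBound T ∧ ∀ st m a, (A.respond st m a).QueryBound T

/-- The protocol with a malicious helper, and an honest server and client; the result is the output
of the server and of the client together with the guess. -/
noncomputable def MaliciousHelper.exec {P : Params} (A : MaliciousHelper P) (O : Oracles P)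
    (st : A.State) (M : FSM P) (x : Input P) : PMF ((ZMod 2 × ZMod 2) × Bool) := do
  let c ← sampleServerCoins P
  let a ← PMF.uniformOfFintype (Shares P)
  let out ← (A.respond st (setupMsg O M c) (helperShares x a)).run O
  let ansS := partialAnswer O (setupMsg O M c) a
  pure ((c.r, clientOutput O ⟨x, a, ansS, startMsg M c, out.1⟩), out.2)

/-- The privacy game for a malicious helper; the outcome says whether it guessed right. -/
noncomputable def MaliciousHelper.game {P : Params} (A : MaliciousHelper P) : PMF Bool := do
  let O ← PMF.uniformOfFintype (Oracles P)
  let ch ← A.choose.run O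
  let b ← PMF.uniformOfFintype Bool
  let y := if b then ch.2.1 else ch.1
  let out ← A.exec O ch.2.2 y.1 y.2
  pure (out.2 == b)

/-- The probability of the outcome `true`. -/
noncomputable def prob (p : PMF Bool) : ℝ := (p true).toReal

end HelperProtocol

open HelperProtocol

/-! Correctness. The two share vectors differ exactly at the one-hot position and both answers carry
the same mask, so their sum is one column of the garbled matrix. Adding the rotation to the state
and removing it again cancel, so evaluation follows the run of the machine: the invariant is that
the client holds the rotated current state and its key.

The malicious server sees only uniform shares, independent of the input, and receives nothing later;
its success probability is exactly one half.

The semi-honest client and the malicious helper are treated by one hybrid argument. If the state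
keys are pairwise distinct, a uniform oracle may be replaced, without changing its law, by a uniform
oracle `O` overwritten with fresh values at the points hidden from the adversary (`avg_reprogram`).
The messages are then padded by these fresh values, and the adversary runs with the overwritten
oracles. Letting it run with `O` instead changes the probability of an outcome by at most the
expected number of its queries, in the run with `O`, at a hidden key (`OracleComp.run_le_run_add`).
In that run the hidden keys are uniform and independent of all that the adversary sees, so `T`
queries hit a given one at most `T / 2 ^ κ` times in expectation (`avg_key_le`). Key collisions cost
a further `(n * nQ) ^ 2 / 2 ^ κ`.

For the client, the hidden points are the rows off its path in the columns of its symbols, and the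
masks. What remains is the path: by the rotations its rotated states are uniform, and so are their
keys. Hence a view can be sampled from `x` and the output share alone (`simView`). For the helper,
the hidden points are all points at which the garbling queries `H`; the matrices become uniform, and
its shares of the input are uniform as well.

The remaining work realises the sampling of `simView` by a straight-line program of polynomial cost
(`Params.simulator`, `expect_run_simulator`, `cost_simulator_le`). -/

namespace HelperProtocol

open scoped ENNReal

/-! ### Expectations over discrete distributions -/

/-- The expectation of a nonnegative function. -/
noncomputable def expect {α : Type*} (p : PMF α) (f : α → ℝ≥0∞) : ℝ≥0∞ := ∑' a, p a * f a

/-- The average over a nonempty finite type. -/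
noncomputable abbrev avg {α : Type*} [Fintype α] [Nonempty α] (f : α → ℝ≥0∞) : ℝ≥0∞ :=
  expect (PMF.uniformOfFintype α) f

section Expect

variable {α β γ : Type*}

lemma pmf_bind_eq {α β : Type} (p : PMF α) (q : α → PMF β) : p >>= q = p.bind q := rfl

lemma pmf_pure_eq {α : Type} (a : α) : (pure a : PMF α) = PMF.pure a := rfl

lemma bind_apply_eq_expect (p : PMF α) (q : α → PMF β) (b : β) :
    (p.bind q) b = expect p fun a => q a b := rfl

lemma expect_pure (a : α) (f : α → ℝ≥0∞) : expect (PMF.pure a) f = f a := by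
  classical
  rw [expect, tsum_eq_single a]
  · simp
  · intro b hb
    simp [PMF.pure_apply, hb]

lemma expect_mono (p : PMF α) {f g : α → ℝ≥0∞} (h : ∀ a, f a ≤ g a) :
    expect p f ≤ expect p g :=
  ENNReal.tsum_le_tsum fun a => mul_le_mul_right (h a) _

lemma expect_add (p : PMF α) (f g : α → ℝ≥0∞) :
    (expect p fun a => f a + g a) = expect p f + expect p g := by
  simp only [expect, mul_add, ENNReal.tsum_add]

lemma expect_const (p : PMF α) (c : ℝ≥0∞) : (expect p fun _ => c) = c := by
  simp [expect, ENNReal.tsum_mul_right, p.tsum_coe]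

lemma expect_le_of_le (p : PMF α) {f : α → ℝ≥0∞} {c : ℝ≥0∞} (h : ∀ a, f a ≤ c) :
    expect p f ≤ c :=
  (expect_mono p h).trans (expect_const p c).le

lemma expect_comm (p : PMF α) (q : PMF β) (f : α → β → ℝ≥0∞) :
    (expect p fun a => expect q fun b => f a b) = expect q fun b => expect p fun a => f a b := by
  simp only [expect, ← ENNReal.tsum_mul_left]
  rw [ENNReal.tsum_comm]
  exact tsum_congr fun b => tsum_congr fun a => by ring

lemma expect_bind (p : PMF α) (q : α → PMF β) (f : β → ℝ≥0∞) :
    expect (p.bind q) f = expect p fun a => expect (q a) f := by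
  simp only [expect, PMF.bind_apply, ← ENNReal.tsum_mul_left, ← ENNReal.tsum_mul_right]
  rw [ENNReal.tsum_comm]
  exact tsum_congr fun b => tsum_congr fun a => by ring

lemma expect_map (p : PMF α) (g : α → β) (f : β → ℝ≥0∞) :
    expect (p.map g) f = expect p fun a => f (g a) := by
  rw [PMF.map, expect_bind]
  simp [expect_pure]

lemma expect_finset_sum (p : PMF α) (s : Finset β) (f : β → α → ℝ≥0∞) :
    (expect p fun a => ∑ b ∈ s, f b a) = ∑ b ∈ s, expect p (f b) := by
  classical
  induction s using Finset.induction_on with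
  | empty => simp [expect]
  | insert b s hb ih => simp [Finset.sum_insert hb, expect_add, ih]

variable [Fintype α] [Nonempty α] [Fintype β] [Nonempty β]

lemma avg_eq (f : α → ℝ≥0∞) : avg f = (Fintype.card α : ℝ≥0∞)⁻¹ * ∑ a, f a := by
  simp [expect, tsum_fintype, Finset.mul_sum]

lemma avg_bijective {e : α → β} (he : e.Bijective) (f : β → ℝ≥0∞) :
    (avg fun a => f (e a)) = avg f := by
  rw [avg_eq, avg_eq, Fintype.card_of_bijective he, he.sum_comp]

lemma avg_prod (f : α × β → ℝ≥0∞) : avg f = avg fun a => avg fun b => f (a, b) := by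
  simp only [avg_eq, Fintype.sum_prod_type, Fintype.card_prod, Nat.cast_mul, ← Finset.mul_sum]
  rw [ENNReal.mul_inv (by simp) (by simp)]
  ring

lemma avg_add_left [AddGroup α] (c : α) (f : α → ℝ≥0∞) : (avg fun a => f (c + a)) = avg f :=
  avg_bijective (Equiv.addLeft c).bijective f

/-- Averages over pairs are invariant under involutions. -/
lemma avg_avg_involutive (e : α × β → α × β) (he : e.Involutive) (f : α × β → ℝ≥0∞) :
    (avg fun a => avg fun b => f (e (a, b))) = avg fun a => avg fun b => f (a, b) := by
  rw [← avg_prod, ← avg_prod fun ab => f (e ab), avg_bijective he.bijective]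

lemma avg_comm (f : α → β → ℝ≥0∞) :
    (avg fun a => avg fun b => f a b) = avg fun b => avg fun a => f a b :=
  expect_comm _ _ f

/-- An entry of a uniformly random matrix is uniform and independent of the other entries. -/
lemma avg_entry {ι κ : Type*} [Fintype ι] [DecidableEq ι] [Fintype κ] [DecidableEq κ] (i : ι)
    (j : κ) (f : (ι → κ → α) → α → ℝ≥0∞)
    (hf : ∀ k v w, f (Function.update k i (Function.update (k i) j v)) w = f k w) :
    (avg fun k => f k (k i j)) = avg fun k => avg fun v => f k v := by
  -- The involution exchanges the entry at `(i, j)` with the fresh value; by `hf` the first argument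
  -- of `f` does not notice.
  have := avg_avg_involutive (fun vk : α × (ι → κ → α) =>
    (vk.2 i j, Function.update vk.2 i (Function.update (vk.2 i) j vk.1)))
    (fun vk => by simp) (fun vk => f vk.2 (vk.2 i j))
  rw [avg_comm]
  simpa [expect_const, hf] using this.symm

/-- The values of a uniformly random matrix at one place in every row are uniform. -/
lemma avg_diagonal {ι : Type*} [Fintype ι] {κ : ι → Type*} [∀ i, Fintype (κ i)]
    [∀ i, DecidableEq (κ i)] [DecidableEq ι] (p : ∀ i, κ i) (f : (ι → α) → ℝ≥0∞) :
    (avg fun k : ∀ i, κ i → α => f fun i => k i (p i)) = avg f := by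
  have := avg_avg_involutive (fun vg : (ι → α) × (∀ i, κ i → α) =>
    ((fun i => vg.2 i (p i)), fun i => Function.update (vg.2 i) (p i) (vg.1 i)))
    (fun vg => by simp) (fun vg => f vg.1)
  simpa [expect_const] using this

end Expect

/-! ### Reprogramming a random oracle -/

section Reprogram

variable {ι X Y : Type*}

open Classical in
/-- The function `g`, with the value at `f i` replaced by `w i` for all `i ∈ s`. -/
noncomputable def reprogram (f : ι → X) (s : Set ι) (w : ι → Y) (g : X → Y) : X → Y :=
  fun x => if h : ∃ i ∈ s, f i = x then w h.choose else g x

lemma reprogram_apply_mem {f : ι → X} {s : Set ι} (hf : s.InjOn f) (w : ι → Y) (g : X → Y) {i : ι}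
    (hi : i ∈ s) : reprogram f s w g (f i) = w i := by
  have h : ∃ j ∈ s, f j = f i := ⟨i, hi, rfl⟩
  rw [reprogram, dif_pos h, hf h.choose_spec.1 hi h.choose_spec.2]

lemma reprogram_apply_of_notMem {f : ι → X} {s : Set ι} (w : ι → Y) (g : X → Y) {x : X}
    (hx : ∀ i ∈ s, f i ≠ x) : reprogram f s w g x = g x := by
  rw [reprogram, dif_neg]
  simpa using hx

/-- A uniformly random function may be reprogrammed with fresh random values. -/
lemma avg_reprogram [Fintype ι] [DecidableEq ι] [Fintype X] [DecidableEq X] [Fintype Y]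
    [Nonempty Y] {f : ι → X} {s : Set ι} (hf : s.InjOn f) (F : (X → Y) → ℝ≥0∞) :
    avg F = avg fun g : X → Y => avg fun w : ι → Y => F (reprogram f s w g) := by
  classical
  -- The involution swaps the values of `g` at the points `f i`, `i ∈ s`, with the fresh values `w
  -- i`; injectivity on `s` makes this well defined.
  have := avg_avg_involutive (fun gw : (X → Y) × (ι → Y) =>
    (reprogram f s gw.2 gw.1, fun i => if i ∈ s then gw.1 (f i) else gw.2 i))
    (fun gw => by
      ext x
      · by_cases hx : ∃ i ∈ s, f i = x
        · obtain ⟨i, hi, rfl⟩ := hx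
          simp [reprogram_apply_mem hf, hi]
        · push Not at hx
          simp [reprogram_apply_of_notMem _ _ hx]
      · by_cases hx : x ∈ s
        · simp [hx, reprogram_apply_mem hf]
        · simp [hx]) (fun gw => F gw.1)
  simpa [expect_const] using this.symm

end Reprogram

/-! ### Oracle computations -/

namespace OracleComp

variable {P : Params} {α β : Type}

/-- Sequential composition. -/
def bind : OracleComp P α → (α → OracleComp P β) → OracleComp P β
  | done a, f => f a
  | random μ next, f => random μ fun v => (next v).bind f
  | queryH k s next, f => queryH k s fun e => (next e).bind f
  | queryMask k i next, f => queryMask k i fun e => (next e).bind f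

lemma run_bind (O : Oracles P) (m : OracleComp P α) (f : α → OracleComp P β) :
    (m.bind f).run O = (m.run O).bind fun a => (f a).run O := by
  induction m with
  | done a => simp [bind, run]
  | random μ next ih => simp [bind, run, ih]
  | queryH k s next ih => exact ih _
  | queryMask k i next ih => exact ih _

open Classical in
/-- The expected number of queries, to either of the oracles, with the key `k`. -/
noncomputable def queries (O : Oracles P) (k : Key P) : OracleComp P α → ℝ≥0∞
  | done _ => 0
  | random μ next => expect μ fun v => (next v).queries O k
  | queryH k' s next => (if k' = k then 1 else 0) + (next (O.H k' s)).queries O k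
  | queryMask k' i next => (if k' = k then 1 else 0) + (next (O.mask k' i)).queries O k

lemma queries_bind (O : Oracles P) (k : Key P) (m : OracleComp P α) (f : α → OracleComp P β) :
    (m.bind f).queries O k = m.queries O k + expect (m.run O) fun a => (f a).queries O k := by
  induction m with
  | done a => simp [bind, queries, run, expect_pure]
  | random μ next ih => simp [bind, queries, run, ih, expect_add, expect_bind]
  | queryH k s next ih => simp [bind, queries, run, ih, add_assoc]
  | queryMask k i next ih => simp [bind, queries, run, ih, add_assoc]

/-- Each query carries a single key, so it contributes one to the sum over all keys. -/
lemma sum_queries_le (O : Oracles P) (m : OracleComp P α) {T : ℕ} (h : m.QueryBound T) :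
    ∑ k, m.queries O k ≤ T := by
  induction m generalizing T with
  | done a => simp [queries]
  | random μ next ih =>
    simp only [queries]
    rw [← expect_finset_sum]
    exact expect_le_of_le _ fun v => ih v (h v)
  | queryH k s next ih =>
    obtain ⟨h0, h⟩ := h
    obtain ⟨T, rfl⟩ := Nat.exists_eq_add_of_lt h0
    have := ih _ (h (O.H k s))
    simp only [queries, Finset.sum_add_distrib, Finset.sum_ite_eq, Finset.mem_univ, if_true]
    refine (add_le_add_right this 1).trans (le_of_eq ?_)
    push_cast [show 0 + T + 1 - 1 = T by omega]
    ring
  | queryMask k i next ih =>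
    obtain ⟨h0, h⟩ := h
    obtain ⟨T, rfl⟩ := Nat.exists_eq_add_of_lt h0
    have := ih _ (h (O.mask k i))
    simp only [queries, Finset.sum_add_distrib, Finset.sum_ite_eq, Finset.mem_univ, if_true]
    refine (add_le_add_right this 1).trans (le_of_eq ?_)
    push_cast [show 0 + T + 1 - 1 = T by omega]
    ring

/-- Two oracles that differ only at the keys `b i` are distinguished only by computations that
query one of these keys. -/
lemma run_le_run_add {ι : Type*} (O O' : Oracles P) (s : Finset ι) (b : ι → Key P)
    (h : ∀ k, (∀ i ∈ s, b i ≠ k) → O'.H k = O.H k ∧ O'.mask k = O.mask k)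
    (m : OracleComp P α) (y : α) :
    m.run O' y ≤ m.run O y + ∑ i ∈ s, m.queries O (b i) ∧
    m.run O y ≤ m.run O' y + ∑ i ∈ s, m.queries O (b i) := by
  -- As soon as a key `b i` is queried the error term is at least one, and both inequalities hold
  -- because probabilities are at most one. Until then the two runs agree, so counting queries under
  -- `O` alone suffices.
  have one_le : ∀ k, ¬ (∀ i ∈ s, b i ≠ k) →
      (1 : ℝ≥0∞) ≤ ∑ i ∈ s, (if k = b i then 1 else 0 : ℝ≥0∞) := by
    intro k hk
    push Not at hk
    obtain ⟨i, hi, rfl⟩ := hk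
    refine le_trans ?_ (Finset.single_le_sum (fun _ _ => zero_le) hi)
    simp
  induction m with
  | done a => simp [run]
  | random μ next ih =>
    simp only [run, queries, bind_apply_eq_expect]
    rw [← expect_finset_sum, ← expect_add, ← expect_add]
    exact ⟨expect_mono _ fun v => (ih v).1, expect_mono _ fun v => (ih v).2⟩
  | queryH k t next ih =>
    simp only [run, queries, Finset.sum_add_distrib]
    by_cases hk : ∀ i ∈ s, b i ≠ k
    · rw [(h k hk).1]
      exact ⟨(ih _).1.trans (add_le_add_right le_add_self _),
        (ih _).2.trans (add_le_add_right le_add_self _)⟩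
    · have := (one_le k hk).trans (le_self_add (b := ∑ i ∈ s, (next (O.H k t)).queries O (b i)))
      exact ⟨(PMF.coe_le_one _ _).trans (le_add_left this),
        (PMF.coe_le_one _ _).trans (le_add_left this)⟩
  | queryMask k t next ih =>
    simp only [run, queries, Finset.sum_add_distrib]
    by_cases hk : ∀ i ∈ s, b i ≠ k
    · rw [(h k hk).2]
      exact ⟨(ih _).1.trans (add_le_add_right le_add_self _),
        (ih _).2.trans (add_le_add_right le_add_self _)⟩
    · have := (one_le k hk).trans (le_self_add (b := ∑ i ∈ s, (next (O.mask k t)).queries O (b i)))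
      exact ⟨(PMF.coe_le_one _ _).trans (le_add_left this),
        (PMF.coe_le_one _ _).trans (le_add_left this)⟩

end OracleComp

/-! ### Uniformly random keys -/

section Keys

variable {P : Params}

/-- Together with `sum_queries_le`, this bounds the expected number of queries at a key that is
independent of the computation. -/
lemma avg_key_le {f : Key P → ℝ≥0∞} {C : ℝ≥0∞} (h : ∑ k, f k ≤ C) : avg f ≤ C / 2 ^ P.κ := by
  rw [avg_eq, mul_comm, ENNReal.div_eq_inv_mul, mul_comm]
  refine (mul_le_mul_right h _).trans (le_of_eq ?_)
  simp [ZMod.card]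

open Classical in
/-- The indicator of two of the keys being equal. -/
noncomputable def collision (k : Fin P.n → Fin P.nQ → Key P) : ℝ≥0∞ :=
  if (Function.uncurry k).Injective then 0 else 1

/-- Uniformly random keys are distinct except with small probability. -/
lemma avg_collision_le (P : Params) :
    (avg fun k : Fin P.n → Fin P.nQ → Key P => collision k) ≤
      ((P.n * P.nQ : ℕ) : ℝ≥0∞) ^ 2 / 2 ^ P.κ := by
  have hle : ∀ k : Fin P.n → Fin P.nQ → Key P,
      collision k ≤
        ∑ u : Fin P.n × Fin P.nQ, ∑ v : Fin P.n × Fin P.nQ,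
          if u ≠ v ∧ k u.1 u.2 = k v.1 v.2 then (1 : ℝ≥0∞) else 0 := by
    intro k
    rw [collision]
    split_ifs with hk
    · exact zero_le
    · simp only [Function.Injective, not_forall] at hk
      obtain ⟨u, v, huv, hne⟩ := hk
      refine (if_pos ⟨hne, huv⟩).symm.le.trans ((Finset.single_le_sum (f := fun v =>
        if u ≠ v ∧ k u.1 u.2 = k v.1 v.2 then (1 : ℝ≥0∞) else 0) (fun _ _ => zero_le)
        (Finset.mem_univ v)).trans ?_)
      exact Finset.single_le_sum (f := fun u => ∑ v : Fin P.n × Fin P.nQ,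
        if u ≠ v ∧ k u.1 u.2 = k v.1 v.2 then (1 : ℝ≥0∞) else 0) (fun _ _ => zero_le)
        (Finset.mem_univ u)
  refine (expect_mono _ hle).trans ?_
  simp only [expect_finset_sum]
  -- Union bound over ordered pairs: for `u ≠ v`, the key at `u` is resampled with the key at `v`
  -- fixed.
  have hb : ∀ u v : Fin P.n × Fin P.nQ, (avg fun k : Fin P.n → Fin P.nQ → Key P =>
      if u ≠ v ∧ k u.1 u.2 = k v.1 v.2 then (1 : ℝ≥0∞) else 0) ≤ 1 / 2 ^ P.κ := by
    intro u v
    by_cases huv : u = v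
    · simp [huv, expect_const]
    · simp only [ne_eq, huv, not_false_eq_true, true_and]
      rw [avg_entry u.1 u.2 fun (k : Fin P.n → Fin P.nQ → Key P) w =>
        if w = k v.1 v.2 then (1 : ℝ≥0∞) else 0]
      · exact expect_le_of_le _ fun k => avg_key_le (by simp)
      · intro k w w'
        by_cases h1 : v.1 = u.1
        · have h2 : v.2 ≠ u.2 := fun h2 => huv (Prod.ext h1.symm h2.symm)
          simp [h1, h2]
        · simp [h1]
  refine (Finset.sum_le_sum fun u _ => Finset.sum_le_sum fun v _ => hb u v).trans (le_of_eq ?_)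
  simp [Fintype.card_prod, div_eq_mul_inv]
  ring

end Keys

/-! ### Correctness -/

lemma bits_add_self {w : ℕ} (b : Bits w) : b + b = 0 :=
  funext fun j => CharTwo.add_self_eq_zero (b j)

lemma entry_add_self {P : Params} (e : Entry P) : e + e = 0 :=
  Prod.ext (bits_add_self e.1) (bits_add_self e.2)

lemma column_add_self {P : Params} (C : Column P) : C + C = 0 :=
  funext fun q => entry_add_self (C q)

lemma ofBits_toBits {w v : ℕ} (hv : v < 2 ^ w) : ofBits (toBits w v) = v := by
  -- The version with truncation needs no bound on `v`, which lets the induction on `w` pass to `v /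
  -- 2`.
  have h : ∀ w v : ℕ, ofBits (toBits w v) = v % 2 ^ w := by
    intro w
    induction w with
    | zero => intro v; simp [ofBits, Nat.mod_one]
    | succ w ih =>
      intro v
      have h1 : ofBits (toBits (w + 1) v) = v % 2 + 2 * ofBits (toBits w (v / 2)) := by
        simp only [ofBits, Fin.sum_univ_succ, Finset.mul_sum]
        congr 1
        · simp only [toBits, Fin.val_zero, pow_zero, mul_one, Nat.testBit_zero]
          rcases Nat.mod_two_eq_zero_or_one v with h | h <;> simp [h]
          rfl
        · refine Finset.sum_congr rfl fun j _ => ?_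
          simp only [toBits, Fin.val_succ, Nat.testBit_succ, pow_succ]
          ring
      rw [h1, ih, pow_succ, mul_comm (2 ^ w) 2, Nat.mod_mul]
  rw [h, Nat.mod_eq_of_lt hv]

lemma toBits_injOn {w v v' : ℕ} (hv : v < 2 ^ w) (hv' : v' < 2 ^ w)
    (h : toBits w v = toBits w v') : v = v' := by
  rw [← ofBits_toBits hv, h, ofBits_toBits hv']

lemma lt_two_pow_clog {N : ℕ} (i : Fin N) : (i : ℕ) < 2 ^ Nat.clog 2 N :=
  i.2.trans_le (Nat.le_pow_clog (by norm_num) N)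

lemma toBits_clog_injective (N : ℕ) :
    Function.Injective fun i : Fin N => toBits (Nat.clog 2 N) i :=
  fun i j h => Fin.ext (toBits_injOn (lt_two_pow_clog i) (lt_two_pow_clog j) h)

variable {P : Params}

/-- The partial answers differ in exactly the column of the client's symbol. -/
lemma partialAnswer_helperShares (O : Oracles P) (m : SetupMsg P) (x : Input P) (a : Shares P) :
    partialAnswer O m (helperShares x a) = partialAnswer O m a + fun i => m.1 i (x i) := by
  funext i
  simp only [partialAnswer, Finset.sum_filter, Pi.add_apply]
  have h2 : ∀ j, (if helperShares x a i j = 1 then m.1 i j else 0)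
      = (if a i j = 1 then m.1 i j else 0) + if j = x i then m.1 i j else 0 := by
    intro j
    -- If the server's share already contains the client's symbol, the helper's sum lacks this
    -- column; removing a column is the same as adding it.
    have h11 : m.1 i j + m.1 i j = 0 := column_add_self _
    simp only [helperShares, oneHot, Pi.add_apply]
    rcases (by decide +revert : ∀ b : ZMod 2, b = 0 ∨ b = 1) (a i j) with hb | hb
    · by_cases hj : x i = j
      · simp [hb, hj]
      · simp [hb, hj, Ne.symm hj]
    · have : (1 : ZMod 2) + 1 ≠ 1 := by decide
      by_cases hj : x i = j
      · simp [hb, hj, h11, this]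
      · simp [hb, hj, Ne.symm hj]
  simp only [h2, Finset.sum_add_distrib, Finset.sum_ite_eq', Finset.mem_univ, if_true]
  abel

/-- A loop invariant: `s i` is the state before step `i`. Indexing by `ℕ` leaves room for the final
state `s n`. -/
lemma foldl_finRange {β : Type*} {n : ℕ} (f : β → Fin n → β) (s : ℕ → β)
    (h : ∀ i : Fin n, f (s i) i = s (i + 1)) : (List.finRange n).foldl f (s 0) = s n := by
  induction n generalizing s with
  | zero => simp
  | succ n ih =>
    rw [List.finRange_succ, List.foldl_cons, List.foldl_map, show f (s 0) 0 = s 1 from h 0]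
    exact ih (fun b i => f b i.succ) (fun i => s (i + 1)) fun i => h i.succ

/-- The state of the machine after `i` symbols. -/
def trace (M : FSM P) (x : Input P) : ℕ → Fin P.nQ
  | 0 => M.start
  | i + 1 => if h : i < P.n then M.step (trace M x i) (x ⟨i, h⟩) else trace M x i

lemma trace_succ (M : FSM P) (x : Input P) (i : Fin P.n) :
    trace M x (i + 1) = M.step (trace M x i) (x i) := by
  simp [trace]

lemma result_eq (M : FSM P) (x : Input P) : result M x = acceptBit M (trace M x P.n) := by
  rw [result, DFA.eval, DFA.evalFrom, List.ofFn_eq_map, List.foldl_map]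
  congr 1
  exact foldl_finRange (fun s i => M.step s (x i)) (trace M x) fun i => (trace_succ M x i).symm

/-- The rotated state after `i` symbols. -/
def position (M : FSM P) (x : Input P) (rot : Fin P.n → Fin P.nQ) (i : Fin P.n) : Fin P.nQ :=
  trace M x i + rot i

/-- The plaintext that the client obtains at position `i`, when its next rotated states are `p`,
their keys are `k`, and its output share is `z`. -/
def nextEntry (z : ZMod 2) (p : Fin P.n → Fin P.nQ) (k : Fin P.n → Key P) (i : Fin P.n) :
    Entry P :=
  if h : (i : ℕ) + 1 < P.n then (toBits P.lQ (p ⟨i + 1, h⟩ : Fin P.nQ), k ⟨i + 1, h⟩)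
  else padShare z

/-- `payload` first removes the rotation that `position` added, so on the path of `x` it encodes the
true transition of the machine. -/
lemma payload_position (M : FSM P) (x : Input P) (c : ServerCoins P) (i : Fin P.n) :
    payload M c i (x i) (position M x c.rot i) =
      nextEntry (c.r + result M x) (position M x c.rot) (fun j => c.k j (position M x c.rot j))
        i := by
  have h1 : position M x c.rot i - c.rot i = trace M x i := by
    rw [position, add_sub_cancel_right]
  rw [payload, h1, nextEntry, ← trace_succ]
  split_ifs with h
  · rfl
  · rw [result_eq, show (i : ℕ) + 1 = P.n by omega]

/-- The answer of the helper is that of the server plus the wanted column, with the same mask; the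
common part cancels in characteristic two. -/
lemma clientView_columns (O : Oracles P) (M : FSM P) (x : Input P) (c : ServerCoins P)
    (a : Shares P) (i : Fin P.n) :
    (clientView O M x c a).columns i = garble O M c i (x i) := by
  simp only [ClientView.columns, clientView, partialAnswer_helperShares, Pi.add_apply, setupMsg]
  rw [← add_assoc, column_add_self, zero_add]

lemma clientOutput_clientView (O : Oracles P) (M : FSM P) (x : Input P) (c : ServerCoins P)
    (a : Shares P) : clientOutput O (clientView O M x c a) = c.r + result M x := by
  set p := position M x c.rot with hp
  -- The invariant of the evaluation. After the last step `evalStep` still decodes a state, from the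
  -- zero state field of the padded share.
  let s : ℕ → Start P := fun i => if h : i < P.n then (p ⟨i, h⟩, c.k ⟨i, h⟩ (p ⟨i, h⟩))
    else (Fin.ofNat P.nQ (ofBits (0 : Bits P.lQ)), (padShare (P := P) (c.r + result M x)).2)
  have h0 : (clientView O M x c a).start = s 0 := by
    simp [s, Nat.pos_of_ne_zero (NeZero.ne P.n), clientView, startMsg, hp, position, trace]
  rw [clientOutput, h0, foldl_finRange _ s]
  · simp [s, padShare]
  · intro i
    have hs : s i = (p i, c.k i (p i)) := by simp [s]
    have he : (clientView O M x c a).columns i (p i) +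
        O.H (c.k i (p i)) (toBits P.lS (x i)) =
        nextEntry (c.r + result M x) p (fun j => c.k j (p j)) i := by
      rw [clientView_columns, garble, hp, payload_position, add_right_comm,
        entry_add_self, zero_add]
    rw [hs]
    simp only [evalStep]
    rw [show (clientView O M x c a).x = x from rfl, he]
    simp only [nextEntry, s]
    split_ifs with h
    · simp [Params.lQ, ofBits_toBits (lt_two_pow_clog _)]
    · rfl

/-! ### Privacy against a malicious server -/

/-- A guess that does not depend on the uniform bit is right with probability one half. -/
lemma avg_bool_beq (p : PMF Bool) :
    (avg fun b : Bool => expect p fun y => PMF.pure (y == b) true) = 2⁻¹ := by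
  have : ∀ y : Bool, (avg fun b : Bool => (PMF.pure (y == b) true : ℝ≥0∞)) = 2⁻¹ := by
    intro y
    rw [avg_eq]
    cases y <;> simp [PMF.pure_apply]
  refine (expect_comm _ p fun b y => PMF.pure (y == b) true).trans ?_
  exact (congrArg (expect p) (funext this)).trans (expect_const p _)

lemma MaliciousServer.game_apply_true (A : MaliciousServer P) : A.game true = 2⁻¹ := by
  have h : ∀ (O : Oracles P) (st : A.State) (x : Bool → Input P),
      (avg fun b : Bool => (expect (A.exec O st (x b)) fun y => PMF.pure (y.2 == b) true)) = 2⁻¹ := by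
    intro O st x
    simp only [MaliciousServer.exec, pmf_bind_eq, pmf_pure_eq, expect_bind,
      expect_pure]
    -- The law of the guess involves neither `b` nor the client's input: the server is shown `a`
    -- only.
    rw [← avg_bool_beq ((PMF.uniformOfFintype (Shares P)).bind fun a =>
      ((A.respond st a).run O).map Prod.snd)]
    simp only [expect_bind, expect_map]
  simp only [MaliciousServer.game, pmf_bind_eq, pmf_pure_eq,
    bind_apply_eq_expect]
  have h' : ∀ (O : Oracles P) (ch : Input P × Input P × A.State),
      (avg fun b : Bool => (expect (A.exec O ch.2.2 (if b then ch.2.1 else ch.1)) fun y =>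
        PMF.pure (y.2 == b) true)) = 2⁻¹ :=
    fun O ch => h O ch.2.2 fun b => if b then ch.2.1 else ch.1
  simp only [h', expect_const]

/-! ### Memory -/

/-- A table of bits, written row after row. -/
def flatten {N w : ℕ} (b : Fin N → Bits w) : Bits (N * w) := fun k => b k.divNat k.modNat

/-- The rows of length `w` of a string of bits. -/
def rows {N w : ℕ} (b : Bits (N * w)) : Fin N → Bits w := fun i j => b (finProdFinEquiv (i, j))

lemma rows_bijective (N w : ℕ) : (rows : Bits (N * w) → Fin N → Bits w).Bijective :=
  ((finProdFinEquiv.arrowCongr (Equiv.refl (ZMod 2))).symm.trans (Equiv.curry _ _ _)).bijective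

lemma row_lt {N w i j : ℕ} (hi : i < N) (hj : j < w) : i * w + j < N * w :=
  calc i * w + j < i * w + w := by omega
    _ = (i + 1) * w := by ring
    _ ≤ N * w := Nat.mul_le_mul_right w hi

lemma rows_apply {N w : ℕ} (b : Bits (N * w)) (i : Fin N) (j : Fin w) :
    rows b i j = b ⟨i * w + j, row_lt i.2 j.2⟩ := by
  simp only [rows]
  congr 1
  ext
  simp [mul_comm, add_comm]

lemma flatten_apply {N w : ℕ} (b : Fin N → Bits w) (i : Fin N) (j : Fin w) :
    flatten b ⟨i * w + j, row_lt i.2 j.2⟩ = b i j := by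
  have hw : 0 < w := by have := j.2; omega
  simp only [flatten]
  congr 1
  · ext
    simp [Fin.divNat, Nat.add_comm _ (j : ℕ), Nat.add_mul_div_right _ _ hw]
  · ext
    simp [Fin.modNat, Nat.add_comm _ (j : ℕ), Nat.mod_eq_of_lt j.2]

namespace Mem

lemma write_of_lt (m : Mem) {d w a : ℕ} (b : Bits w) (h : a < d) : m.write d b a = m a := by
  simp [write, Nat.not_le.2 h]

lemma write_add (m : Mem) {d w j : ℕ} (b : Bits w) (h : j < w) :
    m.write d b (d + j) = b ⟨j, h⟩ := by
  simp [write, h]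

/-- Reduces an identity between memories to the addresses below, inside and above the written block.
-/
lemma write_ext {m m' : Mem} {d w : ℕ} {b : Bits w} (h1 : ∀ a < d, m' a = m a)
    (h2 : ∀ j : Fin w, m' (d + j) = b j) (h3 : ∀ a, d + w ≤ a → m' a = m a) :
    m' = m.write d b := by
  funext a
  by_cases ha : a < d
  · rw [h1 a ha, write_of_lt _ _ ha]
  · obtain ⟨j, rfl⟩ := Nat.exists_eq_add_of_le (Nat.not_lt.1 ha)
    by_cases hj : j < w
    · rw [write_add _ _ hj]
      exact h2 ⟨j, hj⟩
    · rw [h3 _ (by omega)]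
      simp [write, hj]

lemma write_of_le (m : Mem) {d w a : ℕ} (b : Bits w) (h : d + w ≤ a) : m.write d b a = m a := by
  have : ¬ a - d < w := by omega
  simp [write, this]

/-- The induction step for loops that fill a table: appending the last row. -/
lemma write_flatten (m : Mem) (d : ℕ) {N w : ℕ} (b : Fin (N + 1) → Bits w) :
    (m.write d (flatten fun i : Fin N => b i.castSucc)).write (d + N * w) (b (Fin.last N)) =
      m.write d (flatten b) := by
  refine write_ext (fun a ha => ?_) (fun k => ?_) (fun a ha => ?_)
  · rw [write_of_lt _ _ (by omega), write_of_lt _ _ ha]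
  · have hw : 0 < w := by
      rcases Nat.eq_zero_or_pos w with rfl | h
      · exact absurd k.2 (by simp)
      · exact h
    obtain ⟨i, j, hkw, hjw, hk⟩ : ∃ (i j : ℕ) (hi : i < N + 1) (hj : j < w),
        k = ⟨i * w + j, row_lt hi hj⟩ :=
      ⟨(k : ℕ) / w, (k : ℕ) % w, Nat.div_lt_of_lt_mul (k.2.trans_eq (mul_comm _ _)),
        Nat.mod_lt _ hw, Fin.ext (Nat.div_add_mod' _ _).symm⟩
    subst hk
    rw [flatten_apply b ⟨i, hkw⟩ ⟨j, hjw⟩]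
    by_cases hN : i < N
    · have := row_lt hN hjw
      rw [write_of_lt _ _ (by simpa using this), write_add _ _ this,
        flatten_apply _ ⟨i, hN⟩ ⟨j, hjw⟩]
      rfl
    · obtain rfl : i = N := by omega
      simp only
      rw [← add_assoc, write_add _ _ hjw]
      rfl
  · have : d + N * w + w ≤ a := by rw [add_one_mul] at ha; omega
    rw [write_of_le _ _ this, write_of_le _ _ (by omega)]

lemma writeEntry_eq {P : Params} (m : Mem) (d : ℕ) (e : Entry P) :
    m.writeEntry d e = m.write d (Fin.append e.1 e.2) := by
  refine write_ext (fun a ha => ?_) (fun k => ?_) (fun a ha => ?_)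
  · rw [writeEntry, write_of_lt _ _ (by omega), write_of_lt _ _ ha]
  · refine Fin.addCases (fun j => ?_) (fun j => ?_) k
    · rw [writeEntry, write_of_lt _ _ (by simp), Fin.append_left]
      exact write_add _ _ j.2
    · rw [writeEntry, Fin.append_right, Fin.val_natAdd, ← add_assoc]
      exact write_add _ _ j.2
  · rw [writeEntry, write_of_le _ _ (by omega), write_of_le _ _ (by omega)]

end Mem

/-! ### Programs -/

section Programs

variable {P : Params} (O : Oracles P)

lemma execProg_append (l l' : List Instr) (m : Mem) :
    execProg O (l ++ l') m = (execProg O l m).bind fun m' => execProg O l' m' := by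
  induction l generalizing m with
  | nil => simp [execProg]
  | cons I l ih => simp [execProg, ih]

lemma execProg_singleton (I : Instr) (m : Mem) : execProg O [I] m = I.exec O m := by
  simp [execProg]

/-- A loop that fills the rows of a table with independent random values. -/
lemma expect_execProg_sample {α : Type} [Fintype α] [Nonempty α] {A w : ℕ} (enc : α → Bits w)
    (I : ℕ → Instr)
    (hI : ∀ i m, (I i).exec O m =
      (PMF.uniformOfFintype α).map fun v => m.write (A + i * w) (enc v))
    (N : ℕ) (m : Mem) (F : Mem → ℝ≥0∞) :
    expect (execProg O ((List.range N).map I) m) F =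
      avg fun g : Fin N → α => F (m.write A (flatten fun i => enc (g i))) := by
  induction N generalizing F with
  | zero =>
    have : ∀ g : Fin 0 → α, m.write A (flatten fun i => enc (g i)) = m := by
      intro g
      refine (Mem.write_ext (fun _ _ => rfl) (fun k => ?_) (fun _ _ => rfl)).symm
      exact absurd k.2 (by simp)
    simp only [this, expect_const]
    simp [execProg, expect_pure]
  | succ N ih =>
    -- `Fin.snocEquiv` splits off the value sampled last, making the average over `N + 1` values an
    -- iterated one.
    rw [List.range_succ, List.map_append, execProg_append, expect_bind, ih,
      ← avg_bijective (Fin.snocEquiv fun _ : Fin (N + 1) => α).bijective, avg_prod]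
    refine Eq.trans ?_ (expect_comm _ _ _)
    simp only [List.map_singleton, execProg_singleton, hI, expect_map]
    congr 1
    funext g
    congr 1
    funext v
    congr 1
    rw [← Mem.write_flatten]
    simp [Fin.snocEquiv]

/-- A loop that fills the rows of a table with values computed from the memory below. -/
lemma execProg_loop {A w : ℕ} (val : Mem → ℕ → Bits w) (I : ℕ → Instr)
    (hI : ∀ i m, (I i).exec O m = PMF.pure (m.write (A + i * w) (val m i))) (N : ℕ) (m : Mem)
    (hv : ∀ i < N, ∀ m', (∀ a < A, m' a = m a) → val m' i = val m i) :
    execProg O ((List.range N).map I) m =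
      PMF.pure (m.write A (flatten fun i : Fin N => val m i)) := by
  induction N with
  | zero =>
    simp only [List.range_zero, List.map_nil, execProg]
    congr 1
    exact Mem.write_ext (fun _ _ => rfl) (fun k => absurd k.2 (by simp)) (fun _ _ => rfl)
  | succ N ih =>
    rw [List.range_succ, List.map_append, execProg_append,
      ih fun i hi => hv i (by omega), PMF.pure_bind, List.map_singleton, execProg_singleton, hI,
      hv N (by omega) _ fun a ha => Mem.write_of_lt _ _ ha]
    congr 1
    exact Mem.write_flatten m A fun i : Fin (N + 1) => val m i

lemma exec_uniform {u N : ℕ} [NeZero N] (h : u + 1 = N) (d : ℕ) (m : Mem) :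
    (Instr.uniform d u).exec O m = (PMF.uniformOfFintype (Fin N)).map
      fun v : Fin N => m.write d (toBits (Nat.clog 2 N) (v : ℕ)) := by
  subst h
  rw [Instr.exec, pmf_bind_eq, PMF.map_bind]
  simp only [pmf_pure_eq, PMF.pure_map]
  rfl

/-- The program that samples `N` bits. -/
def sampleBits (A N : ℕ) : List Instr := (List.range N).map fun k => Instr.uniform (A + k) 1

lemma expect_execProg_sampleBits (A N : ℕ) (m : Mem) (F : Mem → ℝ≥0∞) :
    expect (execProg O (sampleBits A N) m) F = avg fun g : Bits N => F (m.write A g) := by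
  rw [sampleBits, expect_execProg_sample (α := ZMod 2) (w := 1) (A := A) O (fun v _ => v)]
  · congr 1
    funext g
    congr 1
    refine Mem.write_ext (fun a ha => Mem.write_of_lt _ _ ha) (fun k => ?_)
      (fun a ha => Mem.write_of_le _ _ (by omega))
    rw [Mem.write_add _ _ (show (k : ℕ) < N * 1 by omega)]
    have := flatten_apply (fun i (_ : Fin 1) => g i) k 0
    simpa using this
  · intro i m
    rw [exec_uniform O (N := 2) rfl, mul_one]
    refine congrArg (fun f => PMF.map f (PMF.uniformOfFintype (Fin 2))) (funext fun v => ?_)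
    have hc : Nat.clog 2 2 = 1 := by decide
    -- The width occurs in types, so it becomes a variable before it is replaced by 1.
    generalize Nat.clog 2 2 = w at hc
    subst hc
    congr 1
    funext j
    fin_cases v <;> fin_cases j <;> rfl

lemma exec_hash (d a b : ℕ) (m : Mem) :
    (Instr.hash d a b).exec O m = PMF.pure (m.write d
      (Fin.append (O.H (m.read a P.κ) (m.read b P.lS)).1
        (O.H (m.read a P.κ) (m.read b P.lS)).2)) := by
  rw [Instr.exec, Mem.writeEntry_eq]

end Programs

/-! ### Boolean expressions -/

/-- Polynomials over the field with two elements in the bits of the memory. -/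
inductive BitExpr : Type
  | var (a : ℕ)
  | one
  | add (e f : BitExpr)
  | mul (e f : BitExpr)

namespace BitExpr

def eval (m : Mem) : BitExpr → ZMod 2
  | var a => m a
  | one => 1
  | add e f => e.eval m + f.eval m
  | mul e f => e.eval m * f.eval m

/-- All addresses are below `d`. -/
def Below (d : ℕ) : BitExpr → Prop
  | var a => a < d
  | one => True
  | add e f => e.Below d ∧ f.Below d
  | mul e f => e.Below d ∧ f.Below d

def size : BitExpr → ℕ
  | var _ => 1
  | one => 1
  | add e f => e.size + f.size + 1
  | mul e f => e.size + f.size + 1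

/-- A program that writes the value to the address `d`, and does not change the memory below. -/
def compile : BitExpr → ℕ → List Instr
  | var a, d => [Instr.and d a a]
  | one, d => [Instr.one d]
  | add e f, d => e.compile d ++ f.compile (d + 1) ++ [Instr.xor d d (d + 1)]
  | mul e f, d => e.compile d ++ f.compile (d + 1) ++ [Instr.and d d (d + 1)]

lemma Below.mono {e : BitExpr} {d d' : ℕ} (h : e.Below d) (hd : d ≤ d') : e.Below d' := by
  induction e with
  | var a => exact lt_of_lt_of_le h hd
  | one => trivial
  | add e f ihe ihf => exact ⟨ihe h.1, ihf h.2⟩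
  | mul e f ihe ihf => exact ⟨ihe h.1, ihf h.2⟩

lemma eval_congr {e : BitExpr} {d : ℕ} (h : e.Below d) {m m' : Mem} (hm : ∀ a < d, m' a = m a) :
    e.eval m' = e.eval m := by
  induction e with
  | var a => exact hm a h
  | one => rfl
  | add e f ihe ihf => simp [eval, ihe h.1, ihf h.2]
  | mul e f ihe ihf => simp [eval, ihe h.1, ihf h.2]

lemma cost_compile (P : Params) (e : BitExpr) (d : ℕ) :
    ((e.compile d).map (Instr.cost P)).sum = e.size := by
  induction e generalizing d with
  | var a => rfl
  | one => rfl
  | add e f ihe ihf => simp [compile, size, ihe, ihf, Instr.cost, add_assoc]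
  | mul e f ihe ihf => simp [compile, size, ihe, ihf, Instr.cost, add_assoc]

/-- Memory from `d` on is used as a stack: the left value waits at `d` while the right one is
computed from `d + 1` on. Nothing is claimed above `d`, which is scratch space. -/
lemma exists_execProg_compile {P : Params} (O : Oracles P) (e : BitExpr) (d : ℕ) (h : e.Below d)
    (m : Mem) : ∃ m', execProg O (e.compile d) m = PMF.pure m' ∧ m' d = e.eval m ∧
      ∀ a < d, m' a = m a := by
  have step : ∀ (e f : BitExpr) (I : Instr) (op : ZMod 2 → ZMod 2 → ZMod 2),
      (∀ d, e.Below d → ∀ m, ∃ m', execProg O (e.compile d) m = PMF.pure m' ∧ m' d = e.eval m ∧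
        ∀ a < d, m' a = m a) →
      (∀ d, f.Below d → ∀ m, ∃ m', execProg O (f.compile d) m = PMF.pure m' ∧ m' d = f.eval m ∧
        ∀ a < d, m' a = m a) → ∀ d, e.Below d → f.Below d → ∀ m,
      (∀ m : Mem, I.exec O m = PMF.pure (Function.update m d (op (m d) (m (d + 1))))) →
      ∃ m', execProg O (e.compile d ++ f.compile (d + 1) ++ [I]) m = PMF.pure m' ∧
        m' d = op (e.eval m) (f.eval m) ∧ ∀ a < d, m' a = m a := by
    intro e f I op ihe ihf d he hf m hI
    obtain ⟨m1, h1, h1d, h1a⟩ := ihe d he m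
    obtain ⟨m2, h2, h2d, h2a⟩ := ihf (d + 1) (hf.mono (by omega)) m1
    refine ⟨_, by rw [execProg_append, execProg_append, h1, PMF.pure_bind, h2, PMF.pure_bind,
      execProg_singleton, hI], ?_, fun a ha => ?_⟩
    · rw [Function.update_self, h2a d (by omega), h2d, h1d, eval_congr hf h1a]
    · rw [Function.update_of_ne (by omega), h2a a (by omega), h1a a ha]
  induction e generalizing d m with
  | var a =>
    refine ⟨_, by rw [compile, execProg_singleton, Instr.exec], ?_, fun b hb => ?_⟩
    · rw [Function.update_self, eval]
      -- Bits are idempotent, so the AND of a bit with itself is a copy instruction.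
      exact (by decide : ∀ b : ZMod 2, b * b = b) _
    · rw [Function.update_of_ne (by omega)]
  | one =>
    refine ⟨_, by rw [compile, execProg_singleton, Instr.exec], ?_, fun b hb => ?_⟩
    · rw [Function.update_self, eval]
    · rw [Function.update_of_ne (by omega)]
  | add e f ihe ihf => exact step e f _ (· + ·) ihe ihf d h.1 h.2 m fun m => rfl
  | mul e f ihe ihf => exact step e f _ (· * ·) ihe ihf d h.1 h.2 m fun m => rfl

/-- A program that writes the values of `e 0, …, e (K - 1)` from address `d` on. -/
def compileAll (e : ℕ → BitExpr) (d K : ℕ) : List Instr :=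
  (List.range K).flatMap fun k => (e k).compile (d + k)

/-- The scratch space of the `k`-th expression lies above `d + k`, so results already written
survive; all expressions read below `d`, where memory never changes. -/
lemma exists_execProg_compileAll {P : Params} (O : Oracles P) (e : ℕ → BitExpr) (d K : ℕ)
    (h : ∀ k < K, (e k).Below d) (m : Mem) :
    ∃ m', execProg O (compileAll e d K) m = PMF.pure m' ∧ (∀ a < d, m' a = m a) ∧
      ∀ k < K, m' (d + k) = (e k).eval m := by
  induction K with
  | zero => exact ⟨m, by simp [compileAll, execProg], by simp, by simp⟩
  | succ K ih =>
    obtain ⟨m1, h1, h1a, h1k⟩ := ih fun k hk => h k (by omega)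
    obtain ⟨m2, h2, h2d, h2a⟩ := exists_execProg_compile O (e K) (d + K)
      ((h K (by omega)).mono (by omega)) m1
    refine ⟨m2, ?_, fun a ha => by rw [h2a a (by omega), h1a a ha], fun k hk => ?_⟩
    · rw [compileAll] at h1 ⊢
      rw [List.range_succ, List.flatMap_append, execProg_append, h1, PMF.pure_bind]
      simpa using h2
    · rcases Nat.lt_succ_iff_lt_or_eq.1 hk with hk | rfl
      · rw [h2a _ (by omega), h1k k hk]
      · rw [h2d, eval_congr (h _ (by omega)) h1a]

lemma cost_compileAll (P : Params) (e : ℕ → BitExpr) (d K : ℕ) {C : ℕ}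
    (h : ∀ k < K, (e k).size ≤ C) :
    ((compileAll e d K).map (Instr.cost P)).sum ≤ K * C := by
  induction K with
  | zero => simp [compileAll]
  | succ K ih =>
    have := ih fun k hk => h k (by omega)
    have h1 := h K (by omega)
    rw [compileAll] at this ⊢
    simp only [List.range_succ, List.flatMap_append, List.map_append, List.sum_append,
      List.flatMap_singleton, cost_compile]
    rw [add_one_mul]
    omega

end BitExpr

/-! ### The simulator for the client -/

namespace BitExpr

/-- The indicator of the bits from address `a` on being the binary representation of `v`. -/
def eqConst (a v : ℕ) : ℕ → BitExpr
  | 0 => one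
  | w + 1 => mul (eqConst a v w)
      (if v.testBit w then var (a + w) else add one (var (a + w)))

lemma size_eqConst_le (a v w : ℕ) : (eqConst a v w).size ≤ 4 * w + 1 := by
  induction w with
  | zero => simp [eqConst, size]
  | succ w ih =>
    rw [eqConst]
    split_ifs <;> simp only [size] <;> omega

lemma below_eqConst {a v w d : ℕ} (h : a + w ≤ d) : (eqConst a v w).Below d := by
  induction w with
  | zero => trivial
  | succ w ih =>
    rw [eqConst]
    refine ⟨ih (by omega), ?_⟩
    split_ifs
    · exact (by omega : a + w < d)
    · exact ⟨trivial, (by omega : a + w < d)⟩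

lemma eval_eqConst {a v w v' : ℕ} {m : Mem} (h : ∀ j : Fin w, m (a + j) = toBits w v' j) :
    (eqConst a v w).eval m = if toBits w v = toBits w v' then 1 else 0 := by
  have key : (eqConst a v w).eval m =
      if ∀ j < w, (if v.testBit j then 1 else 0 : ZMod 2) = m (a + j) then 1 else 0 := by
    clear h
    induction w with
    | zero => simp [eqConst, eval]
    | succ w ih =>
      have h2 : ∀ b : ZMod 2, b = 0 ∨ b = 1 := by decide
      have h11 : (1 : ZMod 2) + 1 = 0 := by decide
      simp only [eqConst, eval, ih, Nat.lt_succ_iff_lt_or_eq, or_imp, forall_and, forall_eq]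
      by_cases hall : ∀ j < w, (if v.testBit j then 1 else 0 : ZMod 2) = m (a + j)
      · rcases h2 (m (a + w)) with hb | hb <;> cases v.testBit w <;> simp [eval, hb, h11]
      · simp [hall]
  rw [key]
  congr 1
  rw [funext_iff, Fin.forall_iff]
  refine propext (forall_congr' fun j => forall_congr' fun hj => ?_)
  rw [← h ⟨j, hj⟩]
  rfl

end BitExpr

/-- The columns that the client sees: at the positions `p` they decrypt, with the keys `k`, to the
next position and key, and finally to the output share `z`; everywhere else they are `R`. -/
def simColumns {P : Params} (O : Oracles P) (x : Input P) (z : ZMod 2) (p : Fin P.n → Fin P.nQ)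
    (k : Fin P.n → Key P) (R : Answer P) : Answer P :=
  fun i q => if q = p i then O.H (k i) (toBits P.lS (x i)) + nextEntry z p k i else R i q

/-- `U` stands for the masked answer of the server; the answer of the helper is then forced by the
columns that the client must recover. -/
def simView {P : Params} (O : Oracles P) (x : Input P) (z : ZMod 2) (p : Fin P.n → Fin P.nQ)
    (k : Fin P.n → Key P) (R U : Answer P) (a : Shares P) : ClientView P where
  x := x
  coins := a
  ansS := U
  start := (p 0, k 0)
  ansH := U + simColumns O x z p k R

namespace Params

variable (P : Params)

/-- Bit length of an entry. -/
def lE : ℕ := P.lQ + P.κ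

/-- Memory layout: output share at 0, input, keys, states, rows `R`, answer `U`, coins, hash values,
and from `adrOut` on the output followed by scratch space. -/
def adrKey : ℕ := 1 + P.n * P.lS
def adrState : ℕ := P.adrKey + P.n * P.κ
def adrRow : ℕ := P.adrState + P.n * P.lQ
def adrAns : ℕ := P.adrRow + P.n * (P.nQ * P.lE)
def adrCoins : ℕ := P.adrAns + P.n * (P.nQ * P.lE)
def adrHash : ℕ := P.adrCoins + P.n * P.nS
def adrOut : ℕ := P.adrHash + P.n * P.lE

/-- Bit `j` of the plaintext at position `i`. -/
def nextExpr (i j : ℕ) : BitExpr :=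
  if i + 1 < P.n then
    if j < P.lQ then .var (P.adrState + ((i + 1) * P.lQ + j))
    else .var (P.adrKey + ((i + 1) * P.κ + (j - P.lQ)))
  -- The padded share has its bit first in the key field, at index `lQ`; `1 + 1` is the constant
  -- zero.
  else if j = P.lQ then .var 0 else .add .one .one

/-- Bit `j` of row `q` of the simulated answer of the helper for position `i`. -/
def cellExpr (i q j : ℕ) : BitExpr :=
  let k := i * (P.nQ * P.lE) + (q * P.lE + j)
  -- A multiplexer in characteristic two: `R + [q = p i] * (R + (H + next))` is `H + next` on the
  -- path and `R` off it.
  .add (.var (P.adrAns + k)) (.add (.var (P.adrRow + k))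
    (.mul (.eqConst (P.adrState + i * P.lQ) q P.lQ)
      (.add (.var (P.adrRow + k)) (.add (.var (P.adrHash + (i * P.lE + j))) (P.nextExpr i j)))))

def outExpr (k : ℕ) : BitExpr :=
  P.cellExpr (k / (P.nQ * P.lE)) (k % (P.nQ * P.lE) / P.lE) (k % (P.nQ * P.lE) % P.lE)

def sampleStates : List Instr :=
  (List.range P.n).map fun i => .uniform (P.adrState + i * P.lQ) (P.nQ - 1)

def hashes : List Instr :=
  (List.range P.n).map fun i =>
    .hash (P.adrHash + i * P.lE) (P.adrKey + i * P.κ) (1 + i * P.lS)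

/-- All sampling comes first, in the order of the addresses; the rest is deterministic. `mask` is
never queried, since the answer of the server is sampled directly. -/
def simulator : Simulator P where
  prog := sampleBits P.adrKey (P.n * P.κ) ++ (P.sampleStates ++
    (sampleBits P.adrRow (P.n * (P.nQ * P.lE)) ++ (sampleBits P.adrAns (P.n * (P.nQ * P.lE)) ++
      (sampleBits P.adrCoins (P.n * P.nS) ++ (P.hashes ++
        BitExpr.compileAll P.outExpr P.adrOut (P.n * (P.nQ * P.lE)))))))
  coins := fun i j => P.adrCoins + (i * P.nS + j)
  ansS := fun i q => P.adrAns + (i * (P.nQ * P.lE) + q * P.lE)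
  startState := P.adrState
  startKey := P.adrKey
  ansH := fun i q => P.adrOut + (i * (P.nQ * P.lE) + q * P.lE)

end Params

/-! ### The program computes the simulated view -/

section Simulator

variable {P : Params}

lemma lE_pos (P : Params) : 0 < P.lE := Nat.add_pos_right _ (Nat.pos_of_ne_zero (NeZero.ne P.κ))

lemma outExpr_eq {i q j : ℕ} (hq : q < P.nQ) (hj : j < P.lE) :
    P.outExpr (i * (P.nQ * P.lE) + (q * P.lE + j)) = P.cellExpr i q j := by
  have h := row_lt hq hj
  have h1 : (i * (P.nQ * P.lE) + (q * P.lE + j)) / (P.nQ * P.lE) = i := by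
    rw [Nat.add_comm, Nat.add_mul_div_right _ _ (by omega), Nat.div_eq_of_lt h, zero_add]
  have h2 : (i * (P.nQ * P.lE) + (q * P.lE + j)) % (P.nQ * P.lE) = q * P.lE + j := by
    rw [Nat.mul_add_mod', Nat.mod_eq_of_lt h]
  have h3 : (q * P.lE + j) / P.lE = q := by
    rw [Nat.add_comm, Nat.add_mul_div_right _ _ (lE_pos P), Nat.div_eq_of_lt hj, zero_add]
  have h4 : (q * P.lE + j) % P.lE = j := by rw [Nat.mul_add_mod', Nat.mod_eq_of_lt hj]
  rw [Params.outExpr, h1, h2, h3, h4]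

/-- An entry as a single bit string. -/
def Entry.toBits (e : Entry P) : Bits P.lE := Fin.append e.1 e.2

def Entry.ofBits (b : Bits P.lE) : Entry P :=
  (fun j => b (Fin.castAdd P.κ j), fun j => b (Fin.natAdd P.lQ j))

lemma Entry.toBits_ofBits (b : Bits P.lE) : (Entry.ofBits b).toBits = b :=
  Fin.append_castAdd_natAdd

lemma Entry.ofBits_toBits (e : Entry P) : Entry.ofBits e.toBits = e := by
  ext j <;> simp [Entry.ofBits, Entry.toBits]

lemma Entry.ofBits_bijective : (Entry.ofBits : Bits P.lE → Entry P).Bijective :=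
  Function.bijective_iff_has_inverse.2 ⟨Entry.toBits, Entry.toBits_ofBits, Entry.ofBits_toBits⟩

/-- A table of entries, from its binary representation. -/
def answerOfBits (g : Bits (P.n * (P.nQ * P.lE))) : Answer P :=
  fun i q => Entry.ofBits (rows (rows g i) q)

/-- Hence a block of uniform bits is a uniform table of entries. -/
lemma answerOfBits_bijective : (answerOfBits : _ → Answer P).Bijective := by
  have h1 : (fun (f : Fin P.nQ → Bits P.lE) q => Entry.ofBits (P := P) (f q)).Bijective :=
    Entry.ofBits_bijective.comp_left
  have h2 : (fun (f : Bits (P.nQ * P.lE)) q => Entry.ofBits (P := P) (rows f q)).Bijective :=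
    h1.comp (rows_bijective _ _)
  exact (show (fun (f : Fin P.n → Bits (P.nQ * P.lE)) i q =>
    Entry.ofBits (P := P) (rows (f i) q)).Bijective from h2.comp_left).comp (rows_bijective _ _)

lemma toBits_answerOfBits (g : Bits (P.n * (P.nQ * P.lE))) (i : Fin P.n) (q : Fin P.nQ)
    (j : Fin P.lE) : (answerOfBits g i q).toBits j =
      g ⟨i * (P.nQ * P.lE) + (q * P.lE + j), row_lt i.2 (row_lt q.2 j.2)⟩ := by
  rw [answerOfBits, Entry.toBits_ofBits, rows_apply, rows_apply]

lemma loadInput_read (x : Input P) (z : ZMod 2) (i : Fin P.n) (j : Fin P.lS) :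
    loadInput x z (1 + (i * P.lS + j)) = toBits P.lS (x i) j := by
  have hS : 0 < P.lS := by have := j.2; omega
  have h1 : (i * P.lS + j) / P.lS = (i : ℕ) := by
    rw [Nat.add_comm, Nat.add_mul_div_right _ _ hS, Nat.div_eq_of_lt j.2, zero_add]
  have h2 : (i * P.lS + j) % P.lS = (j : ℕ) := by rw [Nat.mul_add_mod', Nat.mod_eq_of_lt j.2]
  rw [add_comm 1]
  simp [loadInput, h1, h2, toBits]

/-- The random values, and the input, are stored in the memory. -/
structure Loaded (x : Input P) (z : ZMod 2) (p : Fin P.n → Fin P.nQ) (k : Fin P.n → Key P)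
    (R U : Answer P) (a : Shares P) (m : Mem) : Prop where
  share : m 0 = z
  input : ∀ (i : Fin P.n) (j : Fin P.lS), m (1 + (i * P.lS + j)) = toBits P.lS (x i) j
  key : ∀ (i : Fin P.n) (j : Fin P.κ), m (P.adrKey + (i * P.κ + j)) = k i j
  state : ∀ (i : Fin P.n) (j : Fin P.lQ), m (P.adrState + (i * P.lQ + j)) = toBits P.lQ (p i) j
  row : ∀ (i : Fin P.n) (q : Fin P.nQ) (j : Fin P.lE),
    m (P.adrRow + (i * (P.nQ * P.lE) + (q * P.lE + j))) = (R i q).toBits j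
  ans : ∀ (i : Fin P.n) (q : Fin P.nQ) (j : Fin P.lE),
    m (P.adrAns + (i * (P.nQ * P.lE) + (q * P.lE + j))) = (U i q).toBits j
  coins : ∀ (i : Fin P.n) (j : Fin P.nS), m (P.adrCoins + (i * P.nS + j)) = a i j

/-- All these data lie below `adrHash`, so the hash and output phases preserve them. -/
lemma Loaded.congr {x : Input P} {z : ZMod 2} {p : Fin P.n → Fin P.nQ} {k : Fin P.n → Key P}
    {R U : Answer P} {a : Shares P} {m m' : Mem} (h : Loaded x z p k R U a m)
    (hm : ∀ b < P.adrHash, m' b = m b) : Loaded x z p k R U a m' := by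
  have e1 : P.adrHash = P.adrCoins + P.n * P.nS := rfl
  have e2 : P.adrCoins = P.adrAns + P.n * (P.nQ * P.lE) := rfl
  have e3 : P.adrAns = P.adrRow + P.n * (P.nQ * P.lE) := rfl
  have e4 : P.adrRow = P.adrState + P.n * P.lQ := rfl
  have e5 : P.adrState = P.adrKey + P.n * P.κ := rfl
  have e6 : P.adrKey = 1 + P.n * P.lS := rfl
  constructor
  · rw [hm _ (by omega), h.share]
  · intro i j
    have := row_lt i.2 j.2
    rw [hm _ (by omega), h.input]
  · intro i j
    have := row_lt i.2 j.2
    rw [hm _ (by omega), h.key]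
  · intro i j
    have := row_lt i.2 j.2
    rw [hm _ (by omega), h.state]
  · intro i q j
    have := row_lt i.2 (row_lt q.2 j.2)
    rw [hm _ (by omega), h.row]
  · intro i q j
    have := row_lt i.2 (row_lt q.2 j.2)
    rw [hm _ (by omega), h.ans]
  · intro i j
    have := row_lt i.2 j.2
    rw [hm _ (by omega), h.coins]

lemma below_nextExpr (i j : ℕ) (hj : j < P.lE) : (P.nextExpr i j).Below P.adrRow := by
  have e4 : P.adrRow = P.adrState + P.n * P.lQ := rfl
  have e5 : P.adrState = P.adrKey + P.n * P.κ := rfl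
  have e6 : P.adrKey = 1 + P.n * P.lS := rfl
  have e7 : P.lE = P.lQ + P.κ := rfl
  rw [Params.nextExpr]
  split_ifs with h1 h2 h3
  · have := row_lt h1 h2
    exact show _ < _ by omega
  · have := row_lt h1 (show j - P.lQ < P.κ by omega)
    exact show _ < _ by omega
  · exact show _ < _ by omega
  · exact ⟨trivial, trivial⟩

lemma size_nextExpr_le (i j : ℕ) : (P.nextExpr i j).size ≤ 3 := by
  rw [Params.nextExpr]
  split_ifs <;> simp [BitExpr.size]

lemma size_outExpr_le (k : ℕ) : (P.outExpr k).size ≤ 4 * P.lQ + 13 := by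
  have h1 := BitExpr.size_eqConst_le (P.adrState + k / (P.nQ * P.lE) * P.lQ)
    (k % (P.nQ * P.lE) / P.lE) P.lQ
  have h2 := size_nextExpr_le (P := P) (k / (P.nQ * P.lE)) (k % (P.nQ * P.lE) % P.lE)
  simp only [Params.outExpr, Params.cellExpr, BitExpr.size]
  omega

lemma exists_index {k : ℕ} (hk : k < P.n * (P.nQ * P.lE)) :
    ∃ i q j, i < P.n ∧ q < P.nQ ∧ j < P.lE ∧ k = i * (P.nQ * P.lE) + (q * P.lE + j) := by
  have h0 := lE_pos P
  have h1 : 0 < P.nQ * P.lE := Nat.mul_pos (Nat.pos_of_ne_zero (NeZero.ne _)) h0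
  have h2 : k % (P.nQ * P.lE) < P.nQ * P.lE := Nat.mod_lt _ h1
  refine ⟨k / (P.nQ * P.lE), k % (P.nQ * P.lE) / P.lE, k % (P.nQ * P.lE) % P.lE,
    Nat.div_lt_of_lt_mul (hk.trans_eq (mul_comm _ _)),
    Nat.div_lt_of_lt_mul (h2.trans_eq (mul_comm _ _)), Nat.mod_lt _ h0, ?_⟩
  rw [Nat.div_add_mod', Nat.div_add_mod']

lemma below_cellExpr {i q j : ℕ} (hi : i < P.n) (hq : q < P.nQ) (hj : j < P.lE) :
    (P.cellExpr i q j).Below P.adrOut := by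
  have e0 : P.adrOut = P.adrHash + P.n * P.lE := rfl
  have e1 : P.adrHash = P.adrCoins + P.n * P.nS := rfl
  have e2 : P.adrCoins = P.adrAns + P.n * (P.nQ * P.lE) := rfl
  have e3 : P.adrAns = P.adrRow + P.n * (P.nQ * P.lE) := rfl
  have e4 : P.adrRow = P.adrState + P.n * P.lQ := rfl
  have h1 := row_lt hi (row_lt hq hj)
  have h2 := row_lt hi hj
  have h3 : i * P.lQ + P.lQ ≤ P.n * P.lQ := by
    rw [← add_one_mul]
    exact Nat.mul_le_mul_right _ hi
  refine ⟨?_, ?_, BitExpr.below_eqConst (by omega), ?_, ?_,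
    (below_nextExpr i j hj).mono (by omega)⟩ <;> exact show _ < _ by omega

lemma eval_nextExpr {x : Input P} {z : ZMod 2} {p : Fin P.n → Fin P.nQ} {k : Fin P.n → Key P}
    {R U : Answer P} {a : Shares P} {m : Mem} (h : Loaded x z p k R U a m) (i : Fin P.n)
    (j : Fin P.lE) : (P.nextExpr i j).eval m = (nextEntry z p k i).toBits j := by
  rw [Params.nextExpr, nextEntry]
  split_ifs with h1 h2 h3
  · have := h.state ⟨i + 1, h1⟩ ⟨j, h2⟩
    rw [BitExpr.eval, this, Entry.toBits]
    exact (Fin.append_left _ _ ⟨j, h2⟩).symm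
  · have h3 : (j : ℕ) - P.lQ < P.κ := by
      have := j.2
      have e7 : P.lE = P.lQ + P.κ := rfl
      omega
    have := h.key ⟨i + 1, h1⟩ ⟨j - P.lQ, h3⟩
    rw [BitExpr.eval, this, Entry.toBits]
    have hj : j = Fin.natAdd P.lQ ⟨j - P.lQ, h3⟩ := Fin.ext (by simp; omega)
    conv_rhs => rw [hj]
    exact (Fin.append_right _ _ _).symm
  · have hj : j = Fin.natAdd P.lQ (0 : Fin P.κ) := Fin.ext (by simp [h3])
    rw [BitExpr.eval, h.share, Entry.toBits, hj]
    refine Eq.trans ?_ (Fin.append_right _ _ _).symm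
    simp [padShare]
  · have h11 : (1 : ZMod 2) + 1 = 0 := by decide
    rw [BitExpr.eval, BitExpr.eval, h11, Entry.toBits]
    refine Fin.addCases (fun j' h3 => ?_) (fun j' h3 => ?_) j h3
    · rw [Fin.append_left]
      rfl
    · rw [Fin.append_right]
      have : j' ≠ 0 := by
        rintro rfl
        simp at h3
      simp [padShare, this]

lemma Entry.toBits_add (e f : Entry P) (j : Fin P.lE) :
    (e + f).toBits j = e.toBits j + f.toBits j := by
  refine Fin.addCases (fun j => ?_) (fun j => ?_) j <;>
    simp [Entry.toBits]

lemma eval_cellExpr {O : Oracles P} {x : Input P} {z : ZMod 2} {p : Fin P.n → Fin P.nQ}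
    {k : Fin P.n → Key P} {R U : Answer P} {a : Shares P} {m : Mem} (h : Loaded x z p k R U a m)
    (hH : ∀ (i : Fin P.n) (j : Fin P.lE),
      m (P.adrHash + (i * P.lE + j)) = (O.H (k i) (toBits P.lS (x i))).toBits j)
    (i : Fin P.n) (q : Fin P.nQ) (j : Fin P.lE) :
    (P.cellExpr i q j).eval m = ((U + simColumns O x z p k R) i q).toBits j := by
  have he : (BitExpr.eqConst (P.adrState + i * P.lQ) q P.lQ).eval m =
      if q = p i then 1 else 0 := by
    rw [BitExpr.eval_eqConst (v' := p i) fun j => by rw [add_assoc]; exact h.state i j]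
    congr 1
    exact propext ⟨fun h => toBits_clog_injective P.nQ h, fun h => by rw [h]⟩
  simp only [Params.cellExpr, BitExpr.eval, h.ans, h.row, he, hH, eval_nextExpr h, Pi.add_apply,
    Entry.toBits_add, simColumns]
  split_ifs with hq
  -- On the path the two copies of `R` cancel.
  · rw [one_mul, ← add_assoc ((R i q).toBits j), CharTwo.add_self_eq_zero, zero_add,
      Entry.toBits_add]
  · rw [zero_mul, add_zero]

lemma read_entry_eq {m : Mem} {d : ℕ} {e : Entry P} (h : ∀ j : Fin P.lE, m (d + j) = e.toBits j) :
    (m.read d P.lQ, m.read (d + P.lQ) P.κ) = e := by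
  refine Prod.ext (funext fun j => ?_) (funext fun j => ?_)
  · exact (h (Fin.castAdd P.κ j)).trans (Fin.append_left _ _ j)
  · refine Eq.trans ?_ ((h (Fin.natAdd P.lQ j)).trans (Fin.append_right _ _ j))
    simp [Mem.read, add_assoc]

/-- The deterministic half of the simulator, for any memory that already holds the samples. -/
lemma exists_execProg_of_loaded (O : Oracles P) {x : Input P} {z : ZMod 2}
    {p : Fin P.n → Fin P.nQ} {k : Fin P.n → Key P} {R U : Answer P} {a : Shares P} {m : Mem}
    (h : Loaded x z p k R U a m) :
    ∃ m', execProg O (P.hashes ++ BitExpr.compileAll P.outExpr P.adrOut (P.n * (P.nQ * P.lE))) m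
      = PMF.pure m' ∧ P.simulator.view x m' = simView O x z p k R U a := by
  set m1 : Mem := m.write P.adrHash (flatten fun i : Fin P.n =>
    (O.H (m.read (P.adrKey + i * P.κ) P.κ) (m.read (1 + i * P.lS) P.lS)).toBits) with hm1
  have e0 : P.adrOut = P.adrHash + P.n * P.lE := rfl
  have e1 : P.adrHash = P.adrCoins + P.n * P.nS := rfl
  have e2 : P.adrCoins = P.adrAns + P.n * (P.nQ * P.lE) := rfl
  have e3 : P.adrAns = P.adrRow + P.n * (P.nQ * P.lE) := rfl
  have e4 : P.adrRow = P.adrState + P.n * P.lQ := rfl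
  have e5 : P.adrState = P.adrKey + P.n * P.κ := rfl
  have e6 : P.adrKey = 1 + P.n * P.lS := rfl
  have hread : ∀ {m : Mem}, Loaded x z p k R U a m → ∀ i : Fin P.n,
      m.read (P.adrKey + i * P.κ) P.κ = k i ∧ m.read (1 + i * P.lS) P.lS = toBits P.lS (x i) := by
    intro m h i
    refine ⟨funext fun j => ?_, funext fun j => ?_⟩
    · rw [Mem.read, add_assoc, h.key]
    · rw [Mem.read, add_assoc, h.input]
  have hash : execProg O P.hashes m = PMF.pure m1 := by
    refine execProg_loop O (w := P.lE) (fun m i =>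
      (O.H (m.read (P.adrKey + i * P.κ) P.κ) (m.read (1 + i * P.lS) P.lS)).toBits) _
      (fun i m => exec_hash O _ _ _ m) P.n m fun i hi m' hm' => ?_
    obtain ⟨h1, h2⟩ := hread h ⟨i, hi⟩
    obtain ⟨h3, h4⟩ := hread (h.congr hm') ⟨i, hi⟩
    simp only at h1 h2 h3 h4
    simp only [h1, h2, h3, h4]
  obtain ⟨m2, h2, h2a, h2k⟩ := BitExpr.exists_execProg_compileAll O P.outExpr P.adrOut
    (P.n * (P.nQ * P.lE)) (fun k hk => by
      obtain ⟨i, q, j, hi, hq, hj, rfl⟩ := exists_index hk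
      rw [outExpr_eq hq hj]
      exact below_cellExpr hi hq hj) m1
  have hl1 : Loaded x z p k R U a m1 := h.congr fun b hb => Mem.write_of_lt _ _ hb
  have hl2 : Loaded x z p k R U a m2 := hl1.congr fun b hb => h2a b (by omega)
  have hH : ∀ (i : Fin P.n) (j : Fin P.lE),
      m1 (P.adrHash + (i * P.lE + j)) = (O.H (k i) (toBits P.lS (x i))).toBits j := by
    intro i j
    rw [hm1, Mem.write_add _ _ (row_lt i.2 j.2), flatten_apply _ i j, (hread h i).1,
      (hread h i).2]
  refine ⟨m2, by rw [execProg_append, hash, PMF.pure_bind, h2], ?_⟩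
  simp only [Simulator.view, simView, Params.simulator, ClientView.mk.injEq, true_and]
  refine ⟨?_, ?_, ?_, ?_⟩
  · funext i j
    exact hl2.coins i j
  · funext i q
    refine read_entry_eq fun j => ?_
    rw [← hl2.ans, add_assoc, add_assoc]
  · refine Prod.ext ?_ ?_
    · have : m2.read P.adrState P.lQ = toBits P.lQ (p 0) := by
        funext j
        rw [← hl2.state]
        simp [Mem.read]
      rw [this]
      simp [Params.lQ, ofBits_toBits (lt_two_pow_clog _)]
    · funext j
      simp [← hl2.key, Mem.read]
  · funext i q
    refine read_entry_eq fun j => ?_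
    rw [add_assoc, add_assoc, h2k _ (row_lt i.2 (row_lt q.2 j.2)), outExpr_eq q.2 j.2,
      eval_cellExpr hl1 hH]

/-- The output distribution of the simulator. -/
lemma expect_run_simulator (O : Oracles P) (x : Input P) (z : ZMod 2)
    (F : ClientView P → ℝ≥0∞) :
    expect (P.simulator.run O x z) F =
      avg fun k : Fin P.n → Key P => avg fun p : Fin P.n → Fin P.nQ => avg fun R : Answer P =>
        avg fun U : Answer P => avg fun a : Shares P => F (simView O x z p k R U a) := by
  rw [Simulator.run, expect_map]
  simp only [Params.simulator]
  -- Each sampling phase is peeled off as one average, and a bijection turns its raw bits into the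
  -- sampled object.
  rw [execProg_append, expect_bind, expect_execProg_sampleBits,
    ← avg_bijective (rows_bijective P.n P.κ)]
  congr 1; funext gk
  rw [execProg_append, expect_bind, Params.sampleStates,
    expect_execProg_sample O (fun v : Fin P.nQ => toBits P.lQ v) _ fun i m =>
      exec_uniform O (Nat.sub_add_cancel (Nat.pos_of_ne_zero (NeZero.ne P.nQ))) _ m]
  congr 1; funext p
  rw [execProg_append, expect_bind, expect_execProg_sampleBits,
    ← avg_bijective answerOfBits_bijective]
  congr 1; funext gR
  rw [execProg_append, expect_bind, expect_execProg_sampleBits,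
    ← avg_bijective answerOfBits_bijective]
  congr 1; funext gU
  rw [execProg_append, expect_bind, expect_execProg_sampleBits,
    ← avg_bijective (rows_bijective P.n P.nS)]
  congr 1; funext ga
  have e1 : P.adrHash = P.adrCoins + P.n * P.nS := rfl
  have e2 : P.adrCoins = P.adrAns + P.n * (P.nQ * P.lE) := rfl
  have e3 : P.adrAns = P.adrRow + P.n * (P.nQ * P.lE) := rfl
  have e4 : P.adrRow = P.adrState + P.n * P.lQ := rfl
  have e5 : P.adrState = P.adrKey + P.n * P.κ := rfl
  have e6 : P.adrKey = 1 + P.n * P.lS := rfl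
  obtain ⟨m', h1, h2⟩ := exists_execProg_of_loaded O (x := x) (z := z) (p := p) (k := rows gk)
    (R := answerOfBits gR) (U := answerOfBits gU) (a := rows ga) (m := ((((((loadInput x z).write
      P.adrKey gk).write P.adrState (flatten fun i => toBits P.lQ (p i))).write
      P.adrRow gR).write P.adrAns gU).write P.adrCoins ga)) (by
    constructor
    · repeat rw [Mem.write_of_lt _ _ (by omega)]
      rfl
    · intro i j
      have := row_lt i.2 j.2
      repeat rw [Mem.write_of_lt _ _ (by omega)]
      exact loadInput_read x z i j
    · intro i j
      have := row_lt i.2 j.2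
      repeat rw [Mem.write_of_lt _ _ (by omega)]
      rw [Mem.write_add _ _ this, rows_apply]
    · intro i j
      have := row_lt i.2 j.2
      repeat rw [Mem.write_of_lt _ _ (by omega)]
      rw [Mem.write_add _ _ this, flatten_apply _ i j]
    · intro i q j
      have := row_lt i.2 (row_lt q.2 j.2)
      repeat rw [Mem.write_of_lt _ _ (by omega)]
      rw [Mem.write_add _ _ this, toBits_answerOfBits]
    · intro i q j
      have := row_lt i.2 (row_lt q.2 j.2)
      repeat rw [Mem.write_of_lt _ _ (by omega)]
      rw [Mem.write_add _ _ this, toBits_answerOfBits]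
    · intro i j
      have := row_lt i.2 j.2
      rw [Mem.write_add _ _ this, rows_apply])
  rw [h1, expect_pure]
  exact congrArg F h2

/-! ### Cost of the simulator -/

lemma clog_le_self (N : ℕ) : Nat.clog 2 N ≤ N :=
  Nat.clog_le_of_le_pow Nat.lt_two_pow_self.le

lemma cost_simulator_le (P : Params) : P.simulator.cost ≤ (P.size + 2) ^ 9 := by
  have hs : ∀ A N, ((sampleBits A N).map (Instr.cost P)).sum = N * 2 := by
    intro A N
    have : Nat.clog 2 (1 + 1) = 1 := by decide
    simp [sampleBits, Function.comp_def, Instr.cost, this]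
  have h1 : (P.sampleStates.map (Instr.cost P)).sum = P.n * (P.lQ + 1) := by
    simp [Params.sampleStates, Function.comp_def, Instr.cost, Params.lQ,
      Nat.sub_add_cancel (Nat.pos_of_ne_zero (NeZero.ne P.nQ))]
  have h2 : (P.hashes.map (Instr.cost P)).sum = P.n * ((P.κ + P.lS) + (P.lQ + P.κ) + 1) := by
    simp [Params.hashes, Function.comp_def, Instr.cost]
  have h3 := BitExpr.cost_compileAll P P.outExpr P.adrOut (P.n * (P.nQ * P.lE))
    fun k _ => size_outExpr_le (P := P) k
  have hQ : P.lQ ≤ P.nQ := clog_le_self _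
  have hS : P.lS ≤ P.nS := clog_le_self _
  simp only [Simulator.cost, Params.simulator, List.map_append, List.sum_append, hs, h1, h2]
  have hE : P.lE = P.lQ + P.κ := rfl
  have hsz : P.size = P.κ + P.nQ + P.nS + P.n := rfl
  generalize P.size = s at *
  generalize P.lE = E at *
  generalize P.lQ = q at *
  generalize P.lS = b at *
  have k1 : P.n * P.κ ≤ s * s := Nat.mul_le_mul (by omega) (by omega)
  have k2 : P.n * (q + 1) ≤ s * (s + 1) := Nat.mul_le_mul (by omega) (by omega)
  have k3 : P.n * (P.nQ * E) ≤ s * (s * s) :=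
    Nat.mul_le_mul (by omega) (Nat.mul_le_mul (by omega) (by omega))
  have k4 : P.n * P.nS ≤ s * s := Nat.mul_le_mul (by omega) (by omega)
  have k5 : P.n * ((P.κ + b) + (q + P.κ) + 1) ≤ s * (2 * s + 1) :=
    Nat.mul_le_mul (by omega) (by omega)
  have k6 : P.n * (P.nQ * E) * (4 * q + 13) ≤ s * (s * s) * (4 * s + 13) :=
    Nat.mul_le_mul k3 (by omega)
  refine le_trans (b := s * s * 4 + s * (s + 1) + s * (s * s) * 4 + s * (2 * s + 1) +
    s * (s * s) * (4 * s + 13)) (by omega) ?_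
  -- The cost is at most `32 * (s + 2) ^ 4`; absorbing the constant gives the exponent 9.
  have h32 : (32 : ℕ) ≤ (s + 2) ^ 5 := by
    calc 32 = 2 ^ 5 := by norm_num
      _ ≤ _ := Nat.pow_le_pow_left (by omega) _
  calc _ ≤ 32 * (s + 2) ^ 4 := by
        ring_nf
        nlinarith [Nat.zero_le (s ^ 2), Nat.zero_le (s ^ 3), Nat.zero_le (s ^ 4)]
    _ ≤ (s + 2) ^ 5 * (s + 2) ^ 4 := Nat.mul_le_mul_right _ h32
    _ = (s + 2) ^ 9 := by ring

end Simulator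

/-! ### Security against a semi-honest client -/

section Client

variable {P : Params}

lemma expect_sampleServerCoins (F : ServerCoins P → ℝ≥0∞) :
    expect (sampleServerCoins P) F = avg fun k => avg fun rot => avg fun r => avg fun kSH =>
      F ⟨k, rot, r, kSH⟩ := by
  simp only [sampleServerCoins, pmf_bind_eq, pmf_pure_eq, expect_bind, expect_pure]

/-- The keys that the client does not get: `none` stands for the key of the server and the
helper, and `some (i, q)` for the key of the state `q` at position `i`. -/
def hiddenKey (k : Fin P.n → Fin P.nQ → Key P) (kSH : Key P) :
    Option (Fin P.n × Fin P.nQ) → Key P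
  | none => kSH
  | some u => k u.1 u.2

/-- The indices of the keys that the client does not get when it visits the states `p`. -/
def hiddenIndices (p : Fin P.n → Fin P.nQ) : Finset (Option (Fin P.n × Fin P.nQ)) :=
  Finset.univ.filter fun o => ∀ u, o = some u → u.2 ≠ p u.1

/-- The oracles, reprogrammed at the points that hide the rows that the client does not decrypt
and the answers of the server. -/
noncomputable def hiddenOracles (x : Input P) (p : Fin P.n → Fin P.nQ)
    (k : Fin P.n → Fin P.nQ → Key P) (kSH : Key P) (O : Oracles P)
    (W : Fin P.n × Fin P.nQ → Entry P) (V : Answer P) : Oracles P :=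
  (reprogram (fun u : Fin P.n × Fin P.nQ => (k u.1 u.2, toBits P.lS (x u.1)))
    {u | u.2 ≠ p u.1} W O.1,
   reprogram (fun i : Fin P.n => (kSH, toBits P.ln i)) Set.univ V O.2)

/-- The keys alone separate the points, even where symbols repeat. -/
lemma injOn_hidden {x : Input P} {k : Fin P.n → Fin P.nQ → Key P}
    (hk : (Function.uncurry k).Injective) (s : Set (Fin P.n × Fin P.nQ)) :
    s.InjOn fun u : Fin P.n × Fin P.nQ => (k u.1 u.2, toBits P.lS (x u.1)) :=
  fun _ _ _ _ h => hk (congrArg Prod.fst h)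

lemma injOn_position (kSH : Key P) (s : Set (Fin P.n)) :
    s.InjOn fun i : Fin P.n => (kSH, toBits P.ln i) :=
  fun _ _ _ _ h => toBits_clog_injective P.n (congrArg Prod.snd h)

lemma avg_hiddenOracles {x : Input P} {p : Fin P.n → Fin P.nQ} {k : Fin P.n → Fin P.nQ → Key P}
    (hk : (Function.uncurry k).Injective) (kSH : Key P) (F : Oracles P → ℝ≥0∞) :
    avg F = avg fun O : Oracles P => avg fun W => avg fun V =>
      F (hiddenOracles x p k kSH O W V) := by
  rw [avg_prod, avg_prod]
  refine (avg_reprogram (injOn_hidden (x := x) hk {u | u.2 ≠ p u.1})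
    fun O1 => avg fun O2 => F (O1, O2)).trans ?_
  congr 1; funext O1
  refine Eq.trans ?_ (avg_comm _)
  congr 1; funext W
  exact avg_reprogram (injOn_position kSH Set.univ) fun O2 : Key P × Bits P.ln → Column P =>
    F (reprogram (fun u : Fin P.n × Fin P.nQ => (k u.1 u.2, toBits P.lS (x u.1)))
      {u | u.2 ≠ p u.1} W O1, O2)

lemma hiddenOracles_eq {x : Input P} {p : Fin P.n → Fin P.nQ} {k : Fin P.n → Fin P.nQ → Key P}
    {kSH : Key P} {O : Oracles P} {W : Fin P.n × Fin P.nQ → Entry P} {V : Answer P} (k' : Key P)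
    (h : ∀ o ∈ hiddenIndices p, hiddenKey k kSH o ≠ k') :
    (hiddenOracles x p k kSH O W V).H k' = O.H k' ∧
      (hiddenOracles x p k kSH O W V).mask k' = O.mask k' := by
  constructor
  · funext s
    refine reprogram_apply_of_notMem _ _ fun u hu he => ?_
    refine h (some u) (Finset.mem_filter.2 ⟨Finset.mem_univ _, fun v hv => ?_⟩)
      (congrArg Prod.fst he)
    cases hv
    exact hu
  · funext s
    refine reprogram_apply_of_notMem _ _ fun i _ he => ?_
    exact h none (by simp [hiddenIndices]) (congrArg Prod.fst he)

/-- Off the path, `W` pads the payload. On the path the oracle is untouched, as distinct keys keep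
its points out of the reprogrammed set. `V` is the mask of the answers; `O'` has zero mask, so that
the term added to `V` does not itself depend on `V`. -/
lemma clientView_hiddenOracles (M : FSM P) (x : Input P) (c : ServerCoins P) (a : Shares P)
    (hk : (Function.uncurry c.k).Injective) (O : Oracles P) (W : Fin P.n × Fin P.nQ → Entry P)
    (V : Answer P) :
    let p := position M x c.rot
    let O' : Oracles P := ((hiddenOracles x p c.k c.kSH O W 0).1, 0)
    clientView (hiddenOracles x p c.k c.kSH O W V) M x c a =
      simView O x (c.r + result M x) p (fun i => c.k i (p i))
        ((fun i q => payload M c i (x i) q) + fun i q => W (i, q))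
        (partialAnswer O' (setupMsg O' M c) a + V) a := by
  intro p O'
  set O'' := hiddenOracles x p c.k c.kSH O W V with hO''
  have hans : partialAnswer O'' (setupMsg O'' M c) a =
      partialAnswer O' (setupMsg O' M c) a + V := by
    have hm : ∀ i : Fin P.n, O''.mask c.kSH (toBits P.ln i) = V i := fun i =>
      reprogram_apply_mem (injOn_position c.kSH Set.univ) V O.2 (Set.mem_univ i)
    funext i
    simp only [partialAnswer, Pi.add_apply]
    rw [show (setupMsg O'' M c).2 = c.kSH from rfl, hm,
      show O'.mask _ _ = 0 from rfl, add_zero]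
    rfl
  simp only [clientView, simView, ClientView.mk.injEq, true_and]
  refine ⟨hans, ?_, ?_⟩
  · simp [startMsg, p, position, trace]
  · rw [partialAnswer_helperShares, hans]
    congr 1
    funext i q
    simp only [setupMsg, garble, simColumns, Pi.add_apply]
    split_ifs with hq
    · subst hq
      rw [payload_position]
      congr 1
      refine reprogram_apply_of_notMem _ _ fun u hu he => ?_
      have hu' : u = (i, p i) := hk (congrArg Prod.fst he)
      subst hu'
      exact hu rfl
    · rw [add_comm]
      congr 1
      exact reprogram_apply_mem (f := fun u : Fin P.n × Fin P.nQ =>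
        (c.k u.1 u.2, toBits P.lS (x u.1))) (injOn_hidden hk _) W O.1 (i := (i, q)) hq

/-- The client's view, in the reprogrammed oracles, has the distribution of the simulated view. -/
lemma avg_clientView_hiddenOracles (M : FSM P) (x : Input P) (c : ServerCoins P) (a : Shares P)
    (hk : (Function.uncurry c.k).Injective) (O : Oracles P) (F : ClientView P → ℝ≥0∞) :
    (avg fun W => avg fun V =>
      F (clientView (hiddenOracles x (position M x c.rot) c.k c.kSH O W V) M x c a)) =
    avg fun R => avg fun U => F (simView O x (c.r + result M x) (position M x c.rot)
      (fun i => c.k i (position M x c.rot i)) R U a) := by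
  -- `R` is `W` translated by the payload. For each `W`, `U` is `V` translated by the unmasked
  -- answer, which may depend on `W`.
  rw [← avg_bijective ((Equiv.curry (Fin P.n) (Fin P.nQ) (Entry P)).trans
    (Equiv.addLeft fun i q => payload M c i (x i) q)).bijective]
  congr 1; funext W
  simp only [clientView_hiddenOracles M x c a hk O W]
  exact avg_add_left _ fun U => F (simView O x (c.r + result M x) (position M x c.rot)
      (fun i => c.k i (position M x c.rot i)) _ U a)

/-- Real and ideal world for fixed coins. -/
lemma avg_clientView_le (M : FSM P) (x : Input P) (D : Distinguisher P) (c : ServerCoins P)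
    (a : Shares P) :
    let p := position M x c.rot
    let real := avg fun O => (D (clientView O M x c a) c.r).run O true
    let view := fun O R U => simView O x (c.r + result M x) p (fun i => c.k i (p i)) R U a
    let ideal := avg fun O => avg fun R => avg fun U => (D (view O R U) c.r).run O true
    let ε := (avg fun O => avg fun R => avg fun U => ∑ o ∈ hiddenIndices p,
        (D (view O R U) c.r).queries O (hiddenKey c.k c.kSH o)) +
      collision c.k
    real ≤ ideal + ε ∧ ideal ≤ real + ε := by
  intro p real view ideal ε
  by_cases hk : (Function.uncurry c.k).Injective
  -- In `hreal` both the view and the distinguisher use the reprogrammed oracles; in `hideal` only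
  -- the view does, and the distinguisher queries `O`.
  · have hreal : real = avg fun O : Oracles P => avg fun W => avg fun V =>
        (D (clientView (hiddenOracles x p c.k c.kSH O W V) M x c a) c.r).run
          (hiddenOracles x p c.k c.kSH O W V) true := avg_hiddenOracles hk c.kSH _
    have hideal : ideal = avg fun O : Oracles P => avg fun W => avg fun V =>
        (D (clientView (hiddenOracles x p c.k c.kSH O W V) M x c a) c.r).run O true := by
      simp only [ideal]
      congr 1; funext O
      exact (avg_clientView_hiddenOracles M x c a hk O fun v => (D v c.r).run O true).symm
    have hε : ε = avg fun O : Oracles P => avg fun W => avg fun V =>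
        ∑ o ∈ hiddenIndices p,
          (D (clientView (hiddenOracles x p c.k c.kSH O W V) M x c a) c.r).queries O
            (hiddenKey c.k c.kSH o) := by
      simp only [ε, collision, hk, if_true, add_zero]
      congr 1; funext O
      exact (avg_clientView_hiddenOracles M x c a hk O fun v =>
        ∑ o ∈ hiddenIndices p, (D v c.r).queries O (hiddenKey c.k c.kSH o)).symm
    rw [hreal, hideal, hε]
    simp only [← expect_add]
    have key := fun (O : Oracles P) W V => OracleComp.run_le_run_add O
      (hiddenOracles x p c.k c.kSH O W V) (hiddenIndices p) (hiddenKey c.k c.kSH)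
      (fun k' h => hiddenOracles_eq k' h)
      (D (clientView (hiddenOracles x p c.k c.kSH O W V) M x c a) c.r) true
    exact ⟨expect_mono _ fun O => expect_mono _ fun W => expect_mono _ fun V => (key O W V).1,
      expect_mono _ fun O => expect_mono _ fun W => expect_mono _ fun V => (key O W V).2⟩
  -- If two keys collide, the error term is at least one and the claim is trivial.
  · have h1 : (1 : ℝ≥0∞) ≤ ε := by simp [ε, collision, hk]
    have h2 : real ≤ 1 := expect_le_of_le _ fun O => PMF.coe_le_one _ _
    have h3 : ideal ≤ 1 := expect_le_of_le _ fun O => expect_le_of_le _ fun R =>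
      expect_le_of_le _ fun U => PMF.coe_le_one _ _
    exact ⟨h2.trans (le_add_left h1), h3.trans (le_add_left h1)⟩

/-- A distinguisher is unlikely to query a key that the client does not get. -/
lemma avg_hidden_queries_le (x : Input P) (z r : ZMod 2) (p : Fin P.n → Fin P.nQ)
    (D : Distinguisher P) {T : ℕ} (hD : ∀ v r, (D v r).QueryBound T) :
    (avg fun k => avg fun kSH => avg fun a => avg fun O => avg fun R => avg fun U =>
      ∑ o ∈ hiddenIndices p, (D (simView O x z p (fun i => k i (p i)) R U a) r).queries O
        (hiddenKey k kSH o)) ≤ ((P.n * P.nQ + 1) * T : ℕ) / 2 ^ P.κ := by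
  -- Expected number of queries at `v` when the keys on the path are `κ`. The simulated view depends
  -- on no other keys, so a hidden one can be resampled after it.
  let Λ : (Fin P.n → Key P) → Key P → ℝ≥0∞ := fun κ v =>
    avg fun a => avg fun O => avg fun R => avg fun U =>
      (D (simView O x z p κ R U a) r).queries O v
  have hΛ : ∀ κ, avg (Λ κ) ≤ T / 2 ^ P.κ := fun κ => avg_key_le (by
    simp only [Λ, ← expect_finset_sum]
    exact expect_le_of_le _ fun a => expect_le_of_le _ fun O => expect_le_of_le _ fun R =>
      expect_le_of_le _ fun U => OracleComp.sum_queries_le O _ (hD _ _))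
  have key : ∀ o ∈ hiddenIndices p, (avg fun k => avg fun kSH =>
      Λ (fun i => k i (p i)) (hiddenKey k kSH o)) ≤ T / 2 ^ P.κ := by
    rintro (_ | u) hu
    · exact expect_le_of_le _ fun k => hΛ _
    · have hu' : p u.1 ≠ u.2 := by
        have := (Finset.mem_filter.1 hu).2 u rfl
        exact this.symm
      simp only [hiddenKey, expect_const]
      rw [avg_entry u.1 u.2 fun k v => Λ (fun i => k i (p i)) v]
      · exact expect_le_of_le _ fun k => hΛ _
      · intro k v w
        congr 1
        funext i
        by_cases hi : i = u.1
        · subst hi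
          simp [hu']
        · simp [hi]
  simp only [expect_finset_sum]
  refine (Finset.sum_le_sum key).trans ?_
  rw [Finset.sum_const, nsmul_eq_mul]
  have hcard : (hiddenIndices p).card ≤ P.n * P.nQ + 1 := by
    refine (Finset.card_le_univ _).trans (le_of_eq ?_)
    simp
  rw [Nat.cast_mul, mul_div_assoc]
  exact mul_le_mul_left (by exact_mod_cast hcard) _

/-- The rotations act as a one-time pad on the run: uniform rotations give uniform positions. -/
lemma position_bijective (M : FSM P) (x : Input P) : (position M x).Bijective :=
  (Equiv.addLeft fun i : Fin P.n => trace M x i).bijective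

/-- The ideal world, with the coins of the server in the protocol. -/
lemma idealClient_eq (M : FSM P) (x : Input P) (D : Distinguisher P) :
    idealClient P.simulator M x D true = expect (sampleServerCoins P) fun c =>
      avg fun a => avg fun O => avg fun R => avg fun U =>
        (D (simView O x (c.r + result M x) (position M x c.rot)
          (fun i => c.k i (position M x c.rot i)) R U a) c.r).run O true := by
  simp only [idealClient, pmf_bind_eq, bind_apply_eq_expect, expect_run_simulator,
    expect_sampleServerCoins, expect_const]
  let Θ : ZMod 2 → (Fin P.n → Fin P.nQ) → (Fin P.n → Key P) → ℝ≥0∞ := fun r p κ =>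
    avg fun a => avg fun O => avg fun R => avg fun U =>
      (D (simView O x (r + result M x) p κ R U a) r).run O true
  have h1 : (avg fun k : Fin P.n → Fin P.nQ → Key P => avg fun rot => avg fun r =>
      Θ r (position M x rot) fun i => k i (position M x rot i)) =
      avg fun r => avg fun κ => avg fun p => Θ r p κ := by
    rw [avg_comm]
    -- The keys on the path are uniform for each fixed choice of the rotations, so the rotations are
    -- averaged outermost.
    have h2 : ∀ rot, (avg fun k : Fin P.n → Fin P.nQ → Key P => avg fun r =>
        Θ r (position M x rot) fun i => k i (position M x rot i)) =
        avg fun κ => avg fun r => Θ r (position M x rot) κ := fun rot =>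
      avg_diagonal (position M x rot) fun κ => avg fun r => Θ r (position M x rot) κ
    simp only [h2]
    rw [avg_bijective (position_bijective M x) fun p => avg fun κ => avg fun r => Θ r p κ,
      avg_comm]
    refine Eq.trans ?_ (avg_comm _)
    congr 1; funext κ
    exact avg_comm _
  refine Eq.trans ?_ h1.symm
  refine (avg_comm _).trans ?_
  congr 1; funext r
  refine (avg_comm _).trans ?_
  congr 1; funext κ
  refine (avg_comm _).trans ?_
  congr 1; funext p
  simp only [Θ]
  refine Eq.trans ?_ (avg_comm _).symm
  congr 1; funext O
  refine Eq.trans ?_ (avg_comm _).symm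
  congr 1; funext R
  exact avg_comm _

lemma realClient_eq (M : FSM P) (x : Input P) (D : Distinguisher P) :
    realClient M x D true = expect (sampleServerCoins P) fun c => avg fun a => avg fun O =>
      (D (clientView O M x c a) c.r).run O true := by
  simp only [realClient, pmf_bind_eq, bind_apply_eq_expect]
  rw [expect_comm]
  congr 1; funext c
  exact avg_comm _

/-- The bound on the advantage of an adversary with `T` queries. -/
noncomputable def advantageBound (P : Params) (T : ℕ) : ℝ≥0∞ :=
  ((P.n * P.nQ + 1) * T + (P.n * P.nQ) ^ 2 : ℕ) / 2 ^ P.κ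

lemma advantageBound_eq (P : Params) (T : ℕ) : advantageBound P T =
    ((P.n * P.nQ + 1) * T : ℕ) / 2 ^ P.κ + ((P.n * P.nQ : ℕ) : ℝ≥0∞) ^ 2 / 2 ^ P.κ := by
  rw [advantageBound, Nat.cast_add, ENNReal.add_div, Nat.cast_pow]

lemma realClient_idealClient_le (M : FSM P) (x : Input P) (D : Distinguisher P) {T : ℕ}
    (hD : ∀ v r, (D v r).QueryBound T) :
    realClient M x D true ≤ idealClient P.simulator M x D true + advantageBound P T ∧
    idealClient P.simulator M x D true ≤ realClient M x D true + advantageBound P T := by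
  let ε : ServerCoins P → Shares P → ℝ≥0∞ := fun c a =>
    (avg fun O => avg fun R => avg fun U => ∑ o ∈ hiddenIndices (position M x c.rot),
        (D (simView O x (c.r + result M x) (position M x c.rot)
          (fun i => c.k i (position M x c.rot i)) R U a) c.r).queries O
            (hiddenKey c.k c.kSH o)) +
      collision c.k
  have hε : (expect (sampleServerCoins P) fun c => avg fun a => ε c a) ≤ advantageBound P T := by
    simp only [ε, expect_add, expect_const]
    rw [advantageBound_eq]
    refine add_le_add ?_ ?_
    · rw [expect_sampleServerCoins]
      refine (avg_comm _).trans_le (expect_le_of_le _ fun rot => ?_)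
      refine (avg_comm _).trans_le (expect_le_of_le _ fun r => ?_)
      exact avg_hidden_queries_le x (r + result M x) r (position M x rot) D hD
    · simp only [expect_sampleServerCoins, expect_const]
      exact avg_collision_le P
  rw [realClient_eq, idealClient_eq]
  have key := avg_clientView_le M x D
  constructor
  · refine le_trans ?_ (add_le_add_right hε _)
    rw [← expect_add]
    refine expect_mono _ fun c => ?_
    rw [← expect_add]
    exact expect_mono _ fun a => (key c a).1
  · refine le_trans ?_ (add_le_add_right hε _)
    rw [← expect_add]
    refine expect_mono _ fun c => ?_
    rw [← expect_add]
    exact expect_mono _ fun a => (key c a).2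

end Client

/-! ### Privacy against a malicious helper -/

namespace MaliciousHelper

variable {P : Params} (A : MaliciousHelper P)

/-- The inputs of the honest parties that the helper chose. -/
def challenge (ch : (FSM P × Input P) × (FSM P × Input P) × A.State) (b : Bool) :
    FSM P × Input P :=
  if b then ch.2.1 else ch.1

/-- The privacy game as a computation of the helper, where the message of the server is computed
with the oracles `O`. -/
noncomputable def attack (c : ServerCoins P) (a : Shares P) (b : Bool) (O : Oracles P) :
    OracleComp P Bool :=
  A.choose.bind fun ch =>
    (A.respond ch.2.2 (setupMsg O (A.challenge ch b).1 c)
      (helperShares (A.challenge ch b).2 a)).bind fun out => .done (out.2 == b)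

lemma run_attack (c : ServerCoins P) (a : Shares P) (b : Bool) (O O' : Oracles P) :
    (A.attack c a b O').run O true = expect (A.choose.run O) fun ch =>
      expect ((A.respond ch.2.2 (setupMsg O' (A.challenge ch b).1 c)
        (helperShares (A.challenge ch b).2 a)).run O) fun out => PMF.pure (out.2 == b) true := by
  simp only [attack, OracleComp.run_bind, bind_apply_eq_expect, OracleComp.run]

lemma queries_attack (c : ServerCoins P) (a : Shares P) (b : Bool) (O O' : Oracles P)
    (v : Key P) :
    (A.attack c a b O').queries O v = A.choose.queries O v + expect (A.choose.run O) fun ch =>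
      (A.respond ch.2.2 (setupMsg O' (A.challenge ch b).1 c)
        (helperShares (A.challenge ch b).2 a)).queries O v := by
  simp only [attack, OracleComp.queries_bind, OracleComp.queries, expect_const, add_zero]

lemma game_apply_true : A.game true = expect (sampleServerCoins P) fun c => avg fun a =>
    avg fun b => avg fun O => (A.attack c a b O).run O true := by
  simp only [game, exec, pmf_bind_eq, pmf_pure_eq, bind_apply_eq_expect, expect_bind, expect_pure,
    run_attack]
  have h : ∀ X : Oracles P → ((FSM P × Input P) × (FSM P × Input P) × A.State) → Bool →
      ServerCoins P → Shares P → ℝ≥0∞,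
      (avg fun O => expect (A.choose.run O) fun ch => avg fun b =>
        expect (sampleServerCoins P) fun c => avg fun a => X O ch b c a) =
      expect (sampleServerCoins P) fun c => avg fun a => avg fun b => avg fun O =>
        expect (A.choose.run O) fun ch => X O ch b c a := by
    intro X
    have h1 : ∀ O, (expect (A.choose.run O) fun ch => avg fun b =>
        expect (sampleServerCoins P) fun c => avg fun a => X O ch b c a) =
        expect (sampleServerCoins P) fun c => avg fun a => avg fun b =>
          expect (A.choose.run O) fun ch => X O ch b c a := by
      intro O
      have h2 : ∀ ch, (avg fun b => expect (sampleServerCoins P) fun c => avg fun a =>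
          X O ch b c a) = expect (sampleServerCoins P) fun c => avg fun a => avg fun b =>
            X O ch b c a := by
        intro ch
        refine (expect_comm _ _ _).trans ?_
        congr 1; funext c
        exact avg_comm _
      simp only [h2]
      refine (expect_comm _ _ _).trans ?_
      congr 1; funext c
      refine (expect_comm _ _ _).trans ?_
      congr 1; funext a
      exact expect_comm _ _ _
    simp only [h1]
    refine (expect_comm _ _ _).trans ?_
    congr 1; funext c
    refine (avg_comm _).trans ?_
    congr 1; funext a
    exact avg_comm _
  exact h fun O ch b c a => expect ((A.respond ch.2.2 (setupMsg O (A.challenge ch b).1 c)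
        (helperShares (A.challenge ch b).2 a)).run O) fun out => PMF.pure (out.2 == b) true

/-- The oracles, reprogrammed at all points that the server queries. -/
noncomputable def padOracles (k : Fin P.n → Fin P.nQ → Key P) (O : Oracles P)
    (W : Fin P.n × Fin P.nS × Fin P.nQ → Entry P) : Oracles P :=
  (reprogram (fun u : Fin P.n × Fin P.nS × Fin P.nQ => (k u.1 u.2.2, toBits P.lS u.2.1))
    Set.univ W O.1, O.2)

lemma injOn_pad {k : Fin P.n → Fin P.nQ → Key P} (hk : (Function.uncurry k).Injective) :
    Set.univ.InjOn fun u : Fin P.n × Fin P.nS × Fin P.nQ =>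
      (k u.1 u.2.2, toBits P.lS u.2.1) := by
  rintro ⟨i, s, q⟩ - ⟨i', s', q'⟩ - h
  have h1 : (i, q) = (i', q') := hk (congrArg Prod.fst h)
  have h2 : s = s' := toBits_clog_injective P.nS (congrArg Prod.snd h)
  simp_all

lemma avg_padOracles {k : Fin P.n → Fin P.nQ → Key P} (hk : (Function.uncurry k).Injective)
    (F : Oracles P → ℝ≥0∞) :
    avg F = avg fun O : Oracles P => avg fun W => F (padOracles k O W) := by
  rw [avg_prod, avg_prod]
  refine (avg_reprogram (injOn_pad hk) fun O1 => avg fun O2 => F (O1, O2)).trans ?_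
  congr 1; funext O1
  exact avg_comm _

lemma setupMsg_padOracles (M : FSM P) {c : ServerCoins P} (hk : (Function.uncurry c.k).Injective)
    (O : Oracles P) (W : Fin P.n × Fin P.nS × Fin P.nQ → Entry P) :
    setupMsg (padOracles c.k O W) M c =
      (fun i s q => payload M c i s q + W (i, s, q), c.kSH) := by
  refine Prod.ext ?_ rfl
  funext i s q
  simp only [setupMsg, garble]
  rw [add_comm]
  congr 1
  exact reprogram_apply_mem (injOn_pad hk) W O.1 (Set.mem_univ (i, s, q))

/-- In the reprogrammed oracles, the garbled matrices are uniformly random. -/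
lemma avg_setupMsg_padOracles {c : ServerCoins P} (hk : (Function.uncurry c.k).Injective)
    {α : Type} (p : PMF α) (M : α → FSM P) (O : Oracles P) (F : α → SetupMsg P → ℝ≥0∞) :
    (avg fun W => expect p fun ch => F ch (setupMsg (padOracles c.k O W) (M ch) c)) =
      expect p fun ch => avg fun G => F ch (G, c.kSH) := by
  refine (expect_comm _ _ _).trans ?_
  congr 1; funext ch
  let e : (Fin P.n × Fin P.nS × Fin P.nQ → Entry P) ≃ Garbled P :=
    (Equiv.curry _ _ _).trans (Equiv.piCongrRight fun _ => Equiv.curry _ _ _)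
  -- The payload depends on the machine chosen by the helper, but that choice was made with `O` and
  -- is independent of `W`; the translation applies once `ch` is fixed.
  rw [← avg_bijective (e.trans
    (Equiv.addLeft fun i s q => payload (M ch) c i s q : Garbled P ≃ Garbled P)).bijective]
  congr 1; funext W
  rw [setupMsg_padOracles _ hk O W]
  rfl

/-- The game with uniformly random garbled matrices. -/
noncomputable def idealGuess (c : ServerCoins P) (a : Shares P) (b : Bool) : ℝ≥0∞ :=
  avg fun O : Oracles P => expect (A.choose.run O) fun ch => avg fun G : Garbled P =>
    expect ((A.respond ch.2.2 (G, c.kSH) (helperShares (A.challenge ch b).2 a)).run O) fun out =>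
      PMF.pure (out.2 == b) true

/-- Translating `a` by the one-hot encoding removes the input from the helper's shares, and the
matrices are uniform already; nothing shown to the helper depends on `b`. -/
lemma avg_idealGuess (c : ServerCoins P) :
    (avg fun a => avg fun b => A.idealGuess c a b) = 2⁻¹ := by
  rw [avg_comm]
  have h : ∀ b, (avg fun a => A.idealGuess c a b) = expect ((PMF.uniformOfFintype (Oracles P)).bind
      fun O => (A.choose.run O).bind fun ch => (PMF.uniformOfFintype (Garbled P)).bind fun G =>
        (PMF.uniformOfFintype (Shares P)).bind fun a =>
          ((A.respond ch.2.2 (G, c.kSH) a).run O).map Prod.snd)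
      fun y => PMF.pure (y == b) true := by
    intro b
    simp only [expect_bind, expect_map, idealGuess]
    refine (avg_comm _).trans ?_
    congr 1; funext O
    refine (expect_comm _ _ _).trans ?_
    congr 1; funext ch
    refine (avg_comm _).trans ?_
    congr 1; funext G
    exact avg_add_left (oneHot (A.challenge ch b).2) fun a =>
      expect ((A.respond ch.2.2 (G, c.kSH) a).run O) fun out => PMF.pure (out.2 == b) true
  simp only [h]
  exact avg_bool_beq _

/-- The expected number of queries with the key `v`. -/
noncomputable def idealQueries (kSH : Key P) (a : Shares P) (b : Bool) (O : Oracles P)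
    (v : Key P) : ℝ≥0∞ :=
  A.choose.queries O v + expect (A.choose.run O) fun ch => avg fun G : Garbled P =>
    (A.respond ch.2.2 (G, kSH) (helperShares (A.challenge ch b).2 a)).queries O v

/-- The hybrid step for the helper. `attack` joins choice and response in one computation, so
queries made before the setup message count too. -/
lemma avg_run_attack_le (c : ServerCoins P) (a : Shares P) (b : Bool) :
    let real := avg fun O => (A.attack c a b O).run O true
    let ε := (avg fun O => ∑ u : Fin P.n × Fin P.nQ,
      A.idealQueries c.kSH a b O (c.k u.1 u.2)) + collision c.k
    real ≤ A.idealGuess c a b + ε ∧ A.idealGuess c a b ≤ real + ε := by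
  intro real ε
  by_cases hk : (Function.uncurry c.k).Injective
  · have hreal : real = avg fun O : Oracles P => avg fun W =>
        (A.attack c a b (padOracles c.k O W)).run (padOracles c.k O W) true :=
      avg_padOracles hk fun O => (A.attack c a b O).run O true
    have hideal : A.idealGuess c a b = avg fun O : Oracles P => avg fun W =>
        (A.attack c a b (padOracles c.k O W)).run O true := by
      simp only [idealGuess, run_attack]
      congr 1; funext O
      exact (avg_setupMsg_padOracles hk (A.choose.run O) (fun ch => (A.challenge ch b).1) O
        fun ch m => expect ((A.respond ch.2.2 m (helperShares (A.challenge ch b).2 a)).run O)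
          fun out => PMF.pure (out.2 == b) true).symm
    have hε : ε = avg fun O : Oracles P => avg fun W => ∑ u : Fin P.n × Fin P.nQ,
        (A.attack c a b (padOracles c.k O W)).queries O (c.k u.1 u.2) := by
      simp only [ε, collision, hk, if_true, add_zero]
      congr 1; funext O
      refine Eq.trans ?_ (expect_finset_sum _ _ _).symm
      refine Finset.sum_congr rfl fun u _ => ?_
      simp only [queries_attack, expect_add, expect_const, idealQueries]
      congr 1
      exact (avg_setupMsg_padOracles hk (A.choose.run O) (fun ch => (A.challenge ch b).1) O
        fun ch m => (A.respond ch.2.2 m (helperShares (A.challenge ch b).2 a)).queries O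
          (c.k u.1 u.2)).symm
    rw [hreal, hideal, hε]
    simp only [← expect_add]
    have key := fun (O : Oracles P) W => OracleComp.run_le_run_add O (padOracles c.k O W)
      Finset.univ (fun u : Fin P.n × Fin P.nQ => c.k u.1 u.2) (fun k' h => ⟨by
        funext s
        refine reprogram_apply_of_notMem _ _ fun u _ he => ?_
        exact h (u.1, u.2.2) (Finset.mem_univ _) (congrArg Prod.fst he), rfl⟩)
      (A.attack c a b (padOracles c.k O W)) true
    exact ⟨expect_mono _ fun O => expect_mono _ fun W => (key O W).1,
      expect_mono _ fun O => expect_mono _ fun W => (key O W).2⟩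
  · have h1 : (1 : ℝ≥0∞) ≤ ε := by simp [ε, collision, hk]
    have h2 : real ≤ 1 := expect_le_of_le _ fun O => PMF.coe_le_one _ _
    have h3 : A.idealGuess c a b ≤ 1 := expect_le_of_le _ fun O => expect_le_of_le _ fun ch =>
      expect_le_of_le _ fun G => expect_le_of_le _ fun out => PMF.coe_le_one _ _
    exact ⟨h2.trans (le_add_left h1), h3.trans (le_add_left h1)⟩

/-- In the ideal game the state keys occur nowhere, so each is independent of all queries. The
factor 2 accounts for the two phases; the `+ 1` is slack that lets `advantageBound` serve here as
well. -/
lemma avg_idealQueries_le {T : ℕ} (hA : A.QueryBound T) (kSH : Key P) (a : Shares P) (b : Bool)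
    (O : Oracles P) :
    (avg fun k : Fin P.n → Fin P.nQ → Key P => ∑ u : Fin P.n × Fin P.nQ,
      A.idealQueries kSH a b O (k u.1 u.2)) ≤ ((P.n * P.nQ + 1) * (2 * T) : ℕ) / 2 ^ P.κ := by
  have hsum : ∑ v, A.idealQueries kSH a b O v ≤ (2 * T : ℕ) := by
    simp only [idealQueries, Finset.sum_add_distrib, ← expect_finset_sum]
    rw [two_mul, Nat.cast_add]
    exact add_le_add (OracleComp.sum_queries_le O _ hA.1) (expect_le_of_le _ fun ch =>
      expect_le_of_le _ fun G => OracleComp.sum_queries_le O _ (hA.2 _ _ _))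
  simp only [expect_finset_sum]
  have key : ∀ u : Fin P.n × Fin P.nQ, (avg fun k : Fin P.n → Fin P.nQ → Key P =>
      A.idealQueries kSH a b O (k u.1 u.2)) ≤ (2 * T : ℕ) / 2 ^ P.κ := by
    intro u
    rw [avg_entry u.1 u.2 fun _ v => A.idealQueries kSH a b O v]
    · exact expect_le_of_le _ fun k => avg_key_le hsum
    · exact fun _ _ _ => rfl
  refine (Finset.sum_le_sum fun u _ => key u).trans ?_
  rw [Finset.sum_const, nsmul_eq_mul, Nat.cast_mul (P.n * P.nQ + 1), mul_div_assoc]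
  refine mul_le_mul_left ?_ _
  exact_mod_cast (show Fintype.card (Fin P.n × Fin P.nQ) ≤ P.n * P.nQ + 1 by simp)

lemma game_le {T : ℕ} (hA : A.QueryBound T) :
    A.game true ≤ 2⁻¹ + advantageBound P (2 * T) ∧
      2⁻¹ ≤ A.game true + advantageBound P (2 * T) := by
  let ε : ServerCoins P → Shares P → Bool → ℝ≥0∞ := fun c a b =>
    (avg fun O => ∑ u : Fin P.n × Fin P.nQ, A.idealQueries c.kSH a b O (c.k u.1 u.2)) +
      collision c.k
  have hε : (expect (sampleServerCoins P) fun c => avg fun a => avg fun b => ε c a b) ≤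
      advantageBound P (2 * T) := by
    simp only [ε, expect_add, expect_const]
    rw [advantageBound_eq]
    refine add_le_add ?_ ?_
    · rw [expect_sampleServerCoins]
      refine (avg_comm _).trans_le (expect_le_of_le _ fun rot => ?_)
      refine (avg_comm _).trans_le (expect_le_of_le _ fun r => ?_)
      refine (avg_comm _).trans_le (expect_le_of_le _ fun kSH => ?_)
      refine (avg_comm _).trans_le (expect_le_of_le _ fun a => ?_)
      refine (avg_comm _).trans_le (expect_le_of_le _ fun b => ?_)
      refine (avg_comm _).trans_le (expect_le_of_le _ fun O => ?_)
      exact A.avg_idealQueries_le hA kSH a b O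
    · simp only [expect_sampleServerCoins, expect_const]
      exact avg_collision_le P
  have hhalf : (2⁻¹ : ℝ≥0∞) = expect (sampleServerCoins P) fun c => avg fun a => avg fun b =>
      A.idealGuess c a b := by simp only [avg_idealGuess, expect_const]
  rw [game_apply_true, hhalf]
  constructor
  · refine le_trans ?_ (add_le_add_right hε _)
    simp only [← expect_add]
    exact expect_mono _ fun c => expect_mono _ fun a => expect_mono _ fun b =>
      (A.avg_run_attack_le c a b).1
  · refine le_trans ?_ (add_le_add_right hε _)
    simp only [← expect_add]
    exact expect_mono _ fun c => expect_mono _ fun a => expect_mono _ fun b =>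
      (A.avg_run_attack_le c a b).2

end MaliciousHelper

/-! ### Negligible functions -/

lemma advantageBound_ne_top (P : Params) (T : ℕ) : advantageBound P T ≠ ⊤ := by
  rw [advantageBound]
  exact ENNReal.div_ne_top (ENNReal.natCast_ne_top _) (by simp)

lemma abs_toReal_sub_le {a b ε : ℝ≥0∞} (ha : a ≠ ⊤) (hb : b ≠ ⊤) (hε : ε ≠ ⊤) (h1 : a ≤ b + ε)
    (h2 : b ≤ a + ε) : |a.toReal - b.toReal| ≤ ε.toReal := by
  have h1' := ENNReal.toReal_mono (ENNReal.add_ne_top.2 ⟨hb, hε⟩) h1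
  have h2' := ENNReal.toReal_mono (ENNReal.add_ne_top.2 ⟨ha, hε⟩) h2
  rw [ENNReal.toReal_add hb hε] at h1'
  rw [ENNReal.toReal_add ha hε] at h2'
  rw [abs_le]
  constructor <;> linarith

lemma toReal_advantageBound_le {P : Params} {T c : ℕ} {l : ℕ} (hκ : l ≤ P.κ)
    (hs : P.size ≤ (l + 2) ^ c) (hT : T ≤ (l + 2) ^ c) :
    (advantageBound P T).toReal ≤ ((l : ℝ) + 2) ^ (4 * c + 2) * (1 / 2) ^ l := by
  have h1 : P.n ≤ (l + 2) ^ c := le_trans (by unfold Params.size; omega) hs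
  have h2 : P.nQ ≤ (l + 2) ^ c := le_trans (by unfold Params.size; omega) hs
  -- With `L = (l + 2) ^ c` the numerator is at most `L ^ 3 + L + L ^ 4 ≤ 4 * L ^ 4`, and `4 ≤ (l +
  -- 2) ^ 2`.
  have hnum : (P.n * P.nQ + 1) * T + (P.n * P.nQ) ^ 2 ≤ (l + 2) ^ (4 * c + 2) := by
    set L := (l + 2) ^ c with hL
    have hL1 : 1 ≤ L := Nat.one_le_pow _ _ (by omega)
    have h3 : P.n * P.nQ ≤ L * L := Nat.mul_le_mul h1 h2
    have h4 : (P.n * P.nQ) ^ 2 ≤ (L * L) ^ 2 := Nat.pow_le_pow_left h3 2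
    have h5 : (P.n * P.nQ + 1) * T ≤ (L * L + 1) * L := Nat.mul_le_mul (by omega) hT
    have h6 : 4 ≤ (l + 2) ^ 2 := by nlinarith
    have h7 : L * L * L ≤ L ^ 4 := by
      calc L * L * L = L ^ 3 := by ring
        _ ≤ L ^ 4 := Nat.pow_le_pow_right hL1 (by omega)
    have h8 : L ≤ L ^ 4 := Nat.le_self_pow (by omega) L
    calc _ ≤ (L * L + 1) * L + (L * L) ^ 2 := by omega
      _ = L * L * L + L + L ^ 4 := by ring
      _ ≤ L ^ 4 * 4 := by omega
      _ ≤ L ^ 4 * (l + 2) ^ 2 := Nat.mul_le_mul_left _ h6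
      _ = _ := by rw [hL]; ring
  have heq : (advantageBound P T).toReal =
      (((P.n * P.nQ + 1) * T + (P.n * P.nQ) ^ 2 : ℕ) : ℝ) * (1 / 2) ^ P.κ := by
    rw [advantageBound, ENNReal.toReal_div, ENNReal.toReal_natCast, one_div, inv_pow,
      div_eq_mul_inv]
    simp
  rw [heq]
  refine mul_le_mul (by exact_mod_cast hnum) ?_ (by positivity) (by positivity)
  exact pow_le_pow_of_le_one (by norm_num) (by norm_num) hκ

lemma negligible_pow_mul_pow (c : ℕ) :
    Negligible fun l => ((l : ℝ) + 2) ^ c * (1 / 2) ^ l := by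
  intro k
  have h := fun j : ℕ => tendsto_pow_const_mul_const_pow_of_abs_lt_one j
    (show |(1 / 2 : ℝ)| < 1 by rw [abs_of_pos] <;> norm_num)
  -- The factor `3 ^ c` comes from `l + 2 ≤ 3 * l` for `l ≥ 1`.
  have h2 := (h (k + c)).const_mul ((3 : ℝ) ^ c)
  rw [mul_zero] at h2
  refine squeeze_zero' (Eventually.of_forall fun l => by positivity) ?_ h2
  filter_upwards [eventually_ge_atTop 1] with l hl
  have hl' : (1 : ℝ) ≤ l := by exact_mod_cast hl
  calc (l : ℝ) ^ k * (((l : ℝ) + 2) ^ c * (1 / 2) ^ l)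
      ≤ (l : ℝ) ^ k * ((3 * (l : ℝ)) ^ c * (1 / 2) ^ l) := by
        gcongr
        linarith
    _ = _ := by ring

lemma Negligible.of_le {f g : ℕ → ℝ} (hg : Negligible g) (h0 : ∀ l, 0 ≤ f l)
    (h : ∀ l, f l ≤ g l) : Negligible f := fun k =>
  squeeze_zero (fun l => mul_nonneg (by positivity) (h0 l))
    (fun l => mul_le_mul_of_nonneg_left (h l) (by positivity)) (hg k)

lemma negligible_advantageBound {P : ℕ → Params} (hP : Admissible P) {T : ℕ → ℕ}
    (hT : PolyBounded T) : Negligible fun l => (advantageBound (P l) (T l)).toReal := by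
  obtain ⟨c, hc⟩ := hP.2
  obtain ⟨d, hd⟩ := hT
  -- `c + d` is a common exponent for the sizes and the number of queries.
  refine (negligible_pow_mul_pow (4 * (c + d) + 2)).of_le (fun l => ENNReal.toReal_nonneg)
    fun l => toReal_advantageBound_le (hP.1 l) ((hc l).trans ?_) ((hd l).trans ?_)
  · exact Nat.pow_le_pow_right (by omega) (by omega)
  · exact Nat.pow_le_pow_right (by omega) (by omega)

lemma PolyBounded.two_mul {T : ℕ → ℕ} (hT : PolyBounded T) : PolyBounded fun l => 2 * T l := by
  obtain ⟨c, hc⟩ := hT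
  refine ⟨c + 1, fun l => ?_⟩
  rw [pow_succ]
  refine (mul_comm 2 (T l)).trans_le ?_
  exact Nat.mul_le_mul (hc l) (by omega : 2 ≤ l + 2)

end HelperProtocol

/-- Correctness and security of the three-party protocol, in the random oracle model. -/
theorem mainTheorem2 :
    -- Recombination and correctness, for all inputs, oracles and coins.
    (∀ (P : Params) (O : Oracles P) (M : FSM P) (x : Input P) (c : ServerCoins P) (a : Shares P),
      (∀ i, (clientView O M x c a).columns i = garble O M c i (x i)) ∧
      clientOutput O (clientView O M x c a) = c.r + result M x) ∧
    -- Simulation security against a semi-honest client, with a polynomial-size simulator.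
    (∃ (S : (P : Params) → Simulator P) (d : ℕ),
      (∀ P, (S P).cost ≤ (P.size + 2) ^ d) ∧
      ∀ P : ℕ → Params, Admissible P →
      ∀ (M : (l : ℕ) → FSM (P l)) (x : (l : ℕ) → Input (P l))
        (D : (l : ℕ) → Distinguisher (P l)) (T : ℕ → ℕ), PolyBounded T →
        (∀ l v r, (D l v r).QueryBound (T l)) →
        Negligible fun l =>
          |prob (realClient (M l) (x l) (D l)) - prob (idealClient (S (P l)) (M l) (x l) (D l))|) ∧
    -- Privacy against a malicious server.
    (∀ P : ℕ → Params, Admissible P →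
      ∀ (A : (l : ℕ) → MaliciousServer (P l)) (T : ℕ → ℕ), PolyBounded T →
        (∀ l, (A l).QueryBound (T l)) →
        Negligible fun l => |prob (A l).game - 1 / 2|) ∧
    -- Privacy against a malicious helper.
    (∀ P : ℕ → Params, Admissible P →
      ∀ (A : (l : ℕ) → MaliciousHelper (P l)) (T : ℕ → ℕ), PolyBounded T →
        (∀ l, (A l).QueryBound (T l)) →
        Negligible fun l => |prob (A l).game - 1 / 2|) := by
  refine ⟨fun P O M x c a => ⟨clientView_columns O M x c a, clientOutput_clientView O M x c a⟩,
    ⟨Params.simulator, 9, cost_simulator_le, fun P hP M x D T hT hD => ?_⟩,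
    fun P _ A T _ _ => ?_, fun P hP A T hT hA => ?_⟩
  · refine (negligible_advantageBound hP hT).of_le (fun l => abs_nonneg _) fun l => ?_
    obtain ⟨h1, h2⟩ := realClient_idealClient_le (M l) (x l) (D l) (hD l)
    exact abs_toReal_sub_le (PMF.apply_ne_top _ _) (PMF.apply_ne_top _ _)
      (advantageBound_ne_top _ _) h1 h2
  · have h : (fun l => |prob (A l).game - 1 / 2|) = fun _ => 0 := by
      funext l
      simp [prob, MaliciousServer.game_apply_true]
    rw [h]
    exact Asymptotics.superpolynomialDecay_zero _ _
  · refine (negligible_advantageBound hP hT.two_mul).of_le (fun l => abs_nonneg _) fun l => ?_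
    obtain ⟨h1, h2⟩ := (A l).game_le (hA l)
    have := abs_toReal_sub_le (PMF.apply_ne_top _ _) (by simp) (advantageBound_ne_top _ _) h1 h2
    simpa [prob] using this
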